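/- **Setting.** Let $(\mathbb X,\mathbb C,\|\cdot\|)$ and $(\mathbb B,\mathbb Y,\|\cdot\|)$ be dual pairs of normed vector spaces: real vector spaces with bilinear forms $\langle\cdot,\cdot\rangle$ that separate points on both sides, $\mathbb X$ and $\mathbb B$ normed (not necessarily complete), and $\mathbb C,\mathbb Y$ carrying the dual norms $\|c\|_*:=\sup_{\|x\|\le1}\langle x,c\rangle$, assumed finite. Let $\mathcal A:\mathbb X\to\mathbb B$ be linear and weakly continuous, $\mathbb K\subset\mathbb B$ a weakly closed convex cone, $\mathbb K^*:=\{y\in\mathbb Y:\langle k,y\rangle\ge0\ \forall k\in\mathbb K\}$, $b\in\mathbb B$, $c\in\mathbb C$. Let $x_1,\dots,x_n\in\mathbb X$ be linearly independent with $\|x_i\|=1$, $\|\cdot\|_{\mathfrak R}$ a norm on $\mathbb R^n$ with dual norm $\|\cdot\|_{\mathfrak R^*}$, and $\theta_{\mathcal P}\in\mathbb R$. Put $\mathcal A_n\alpha:=\sum_{i\le n}\alpha_i\mathcal Ax_i$, $\mathcal A_n^*y:=(\langle\mathcal Ax_i,y\rangle)_{i\le n}$, $\mathbf c:=(\langle x_i,c\rangle)_{i\le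 n}$, $\varrho_n:=\sup_{\|\alpha\|_{\mathfrak R}\le1}\|\alpha\|_{\ell_1}$, $\|\mathcal A\|:=\sup_{\|x\|\le1}\|\mathcal Ax\|$, and $$J_n:=\inf\{\alpha^\top\mathbf c:\ \mathcal A_n\alpha-b\in\mathbb K,\ \|\alpha\|_{\mathfrak R}\le\theta_{\mathcal P}\}.$$ Assume that this program is feasible and that there is $\gamma>0$ with $\|\mathcal A_n^*y\|_{\mathfrak R^*}\ge\gamma\|y\|_*$ for all $y\in\mathbb K^*$ and $\gamma\theta_{\mathcal P}>\|b\|$. For a lower bound $J_n^{\rm LB}\le J_n$ put $$\theta_{\mathcal D}:=\frac{\theta_{\mathcal P}\|\mathbf c\|_{\mathfrak R^*}-J_n^{\rm LB}}{\gamma\theta_{\mathcal P}-\|b\|}.$$ Let $\mathcal K$ be the set of extreme points of $\{y\in\mathbb K^*:\|y\|_*=1\}$, and assume that $\{y\in\mathbb K^*:\|y\|_*\le1\}$ is $\sigma(\mathbb Y,\mathbb B)$-compact (as is the case if $\mathbb Y$ is the norm dual of $\mathbb B$). Let $\mathbb P$ be a probability measure on $\mathbb Y$ supported on $\mathcal K$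 (all functionals $\langle v,\cdot\rangle$, $v\in\mathbb B$, being measurable), let $y_1,\dots,y_N$ be i.i.d. samples from $\mathbb P$, and $$J_{n,N}:=\min\{\alpha^\top\mathbf c:\ \alpha^\top\mathcal A_n^*y_j\ge\langle b,y_j\rangle\ (1\le j\le N),\ \|\alpha\|_{\mathfrak R}\le\theta_{\mathcal P}\}.\qquad(\mathcal P_{n,N})$$ With $\sigma_{\mathcal K}(\delta):=\sup_{y\in\mathcal K}\langle\delta,y\rangle$ and $p(\alpha,\zeta):=\mathbb P[y:\sigma_{\mathcal K}(-\mathcal A_n\alpha+b)<\langle-\mathcal A_n\alpha+b,y\rangle+\zeta]$, a function $h:\mathbb R^n\times[0,1)\to\mathbb R_+$ is a *tail bound* if $h(\alpha,\varepsilon)\ge\sup\{\zeta\ge0:p(\alpha,\zeta)\le\varepsilon\}$ for all $\alpha,\varepsilon$. For $\varepsilon\in[0,1]$ and $\beta>0$ let $$\mathsf N(n,\varepsilon,\beta):=\min\Big\{N\in\mathbb N:\ \sum_{i=0}^{n-1}\binom Ni\varepsilon^i(1-\varepsilon)^{N-i}\le\beta\Big\}$$ ($=\infty$ if there is no such $N$).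 **Theorem (Randomized approximation error).** (a) Let $h$ be a tail bound, $\varepsilon\in(0,1)$, $\beta>0$, $N\ge\mathsf N(n,\varepsilon,\beta)$, and suppose that almost surely $(\mathcal P_{n,N})$ has a unique optimizer $\alpha_N^\star$. Then $$\mathbb P^N\big[0\le J_n-J_{n,N}\le\theta_{\mathcal D}\,h(\alpha_N^\star,\varepsilon)\big]\ge1-\beta .$$ (b) Suppose $\|\mathcal A\|<\infty$ and $\theta_{\mathcal D}>0$, and let $g:\mathbb R_+\to[0,1]$ be non-decreasing with $g(r)\le\mathbb P[y:\|y-\kappa\|_*<r]$ for all $\kappa\in\mathcal K$, $r\ge0$. Put $z_n:=\big(\theta_{\mathcal D}(\theta_{\mathcal P}\varrho_n\|\mathcal A\|+\|b\|)\big)^{-1}$. For all $\varepsilon,\beta>0$ and $N\ge\mathsf N(n,g(z_n\varepsilon),\beta)$, $$\mathbb P^N\big[0\le J_n-J_{n,N}\le\varepsilon\big]\ge1-\beta .$$ (If the events are not measurable, the claim is that they contain measurable events of that probability.) -/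

import Mathlib

open MeasureTheory

noncomputable section

namespace ScenarioLP

/-! ### Dual pairs of normed vector spaces -/

/-- The norm induced on the second space by the norm of the first one and the bilinear form:
`‖c‖_* = sup_{‖x‖ ≤ 1} ⟨x, c⟩`. -/
def dualNorm {X C : Type*} [NormedAddCommGroup X] [NormedSpace ℝ X] [AddCommGroup C] [Module ℝ C]
    (p : X →ₗ[ℝ] C →ₗ[ℝ] ℝ) (c : C) : ℝ :=
  sSup {r : ℝ | ∃ x : X, ‖x‖ ≤ 1 ∧ r = p x c}

/-- The bilinear form `p` makes `(X, C, ‖·‖)` a dual pair of normed vector spaces: it separates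
points on both sides and the supremum in `dualNorm` is finite. -/
structure IsDualPair {X C : Type*} [NormedAddCommGroup X] [NormedSpace ℝ X] [AddCommGroup C]
    [Module ℝ C] (p : X →ₗ[ℝ] C →ₗ[ℝ] ℝ) : Prop where
  separatingLeft : p.SeparatingLeft
  separatingRight : p.SeparatingRight
  bddAbove : ∀ c : C, BddAbove {r : ℝ | ∃ x : X, ‖x‖ ≤ 1 ∧ r = p x c}

/-- `s` is closed for the weak topology `σ(E, F)` of the pairing `p`. -/
def IsWeaklyClosed {E F : Type*} [AddCommGroup E] [Module ℝ E] [AddCommGroup F] [Module ℝ F]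
    (p : E →ₗ[ℝ] F →ₗ[ℝ] ℝ) (s : Set E) : Prop :=
  IsClosed (X := WeakBilin p) s

/-- `s` is compact for the weak topology `σ(E, F)` of the pairing `p`. -/
def IsWeaklyCompact {E F : Type*} [AddCommGroup E] [Module ℝ E] [AddCommGroup F] [Module ℝ F]
    (p : E →ₗ[ℝ] F →ₗ[ℝ] ℝ) (s : Set E) : Prop :=
  IsCompact (X := WeakBilin p) s

/-- The operator norm `sup_{‖x‖ ≤ 1} ‖A x‖`. -/
def opNorm {X B : Type*} [NormedAddCommGroup X] [NormedSpace ℝ X] [NormedAddCommGroup B]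
    [NormedSpace ℝ B] (A : X →ₗ[ℝ] B) : ℝ :=
  sSup {r : ℝ | ∃ x : X, ‖x‖ ≤ 1 ∧ r = ‖A x‖}

/-! ### The semi-infinite program -/

/-- The data of the infinite linear program `inf {⟨x, c⟩ : A x - b ∈ K}` over two dual pairs,
together with the `n` basis elements `x i`, the norm `R` on `ℝⁿ` and the radius `θP` that define
its semi-infinite restriction. -/
structure Program (X C B Y : Type*) [NormedAddCommGroup X] [NormedSpace ℝ X]
    [AddCommGroup C] [Module ℝ C] [NormedAddCommGroup B] [NormedSpace ℝ B]
    [AddCommGroup Y] [Module ℝ Y] (n : ℕ) where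
  /-- the bilinear form of the pair `(X, C)` -/
  pX : X →ₗ[ℝ] C →ₗ[ℝ] ℝ
  /-- the bilinear form of the pair `(B, Y)` -/
  pB : B →ₗ[ℝ] Y →ₗ[ℝ] ℝ
  isDualPair_X : IsDualPair pX
  isDualPair_B : IsDualPair pB
  A : X →ₗ[ℝ] B
  A_continuous : Continuous (X := WeakBilin pX) (Y := WeakBilin pB) A
  K : PointedCone ℝ B
  K_closed : IsWeaklyClosed pB (K : Set B)
  c : C
  b : B
  x : Fin n → X
  x_linearIndependent : LinearIndependent ℝ x
  x_norm : ∀ i, ‖x i‖ = 1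
  R : Seminorm ℝ (Fin n → ℝ)
  R_definite : ∀ α, R α = 0 → α = 0
  θP : ℝ

namespace Program

variable {X C B Y : Type*} [NormedAddCommGroup X] [NormedSpace ℝ X]
  [AddCommGroup C] [Module ℝ C] [NormedAddCommGroup B] [NormedSpace ℝ B]
  [AddCommGroup Y] [Module ℝ Y] {n : ℕ} (L : Program X C B Y n)

/-- `A_n α = ∑ i, α i • A (x i)`. -/
def An (α : Fin n → ℝ) : B := ∑ i, α i • L.A (L.x i)

/-- `A_n^* y = (⟨A (x i), y⟩)_i`. -/
def AnAdj (y : Y) : Fin n → ℝ := fun i => L.pB (L.A (L.x i)) y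

/-- The cost vector `(⟨x i, c⟩)_i`. -/
def cvec : Fin n → ℝ := fun i => L.pX (L.x i) L.c

/-- The dual of the norm `R` on `ℝⁿ` for the standard inner product. -/
def RDual (v : Fin n → ℝ) : ℝ := sSup {r : ℝ | ∃ α : Fin n → ℝ, L.R α ≤ 1 ∧ r = α ⬝ᵥ v}

/-- The ratio `ϱ_n = sup_{R α ≤ 1} ‖α‖_{ℓ₁}`. -/
def rho : ℝ := sSup {r : ℝ | ∃ α : Fin n → ℝ, L.R α ≤ 1 ∧ r = ∑ i, |α i|}

/-- The feasible set of the semi-infinite program `(P_n)`. -/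
def feasible : Set (Fin n → ℝ) := {α | L.An α - L.b ∈ L.K ∧ L.R α ≤ L.θP}

/-- The optimal value `J_n` of `(P_n)`. -/
def Jn : ℝ := sInf ((fun α => α ⬝ᵥ L.cvec) '' L.feasible)

/-- The dual cone `K^* = {y : ⟨k, y⟩ ≥ 0 for all k ∈ K}`. -/
def dualCone : PointedCone ℝ Y := PointedCone.dual L.pB (L.K : Set B)

/-- The dual norm on `Y`. -/
def normY (y : Y) : ℝ := dualNorm L.pB y

/-- The set `𝒦` of extreme points of `{y ∈ K^* : ‖y‖_* = 1}`. -/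
def extremal : Set Y := Set.extremePoints ℝ {y : Y | y ∈ L.dualCone ∧ L.normY y = 1}

/-- Semi-infinite regularity with inf-sup constant `γ`. -/
structure Regular (γ : ℝ) : Prop where
  feasible_nonempty : L.feasible.Nonempty
  γ_pos : 0 < γ
  inf_sup : ∀ y ∈ L.dualCone, γ * L.normY y ≤ L.RDual (L.AnAdj y)
  θP_large : ‖L.b‖ < γ * L.θP

/-- The dual optimizer bound `θ_D` for the inf-sup constant `γ` and the lower bound `JLB`
of `J_n`. -/
def thetaD (γ JLB : ℝ) : ℝ := (L.θP * L.RDual L.cvec - JLB) / (γ * L.θP - ‖L.b‖)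

/-! ### The scenario program -/

/-- The feasible set of the scenario program `(P_{n,N})` for the samples `ω 0, …, ω (N-1)`. -/
def feasibleN {N : ℕ} (ω : Fin N → Y) : Set (Fin n → ℝ) :=
  {α | (∀ j, L.pB L.b (ω j) ≤ α ⬝ᵥ L.AnAdj (ω j)) ∧ L.R α ≤ L.θP}

/-- The optimal value `J_{n,N}` of `(P_{n,N})`. -/
def JnN {N : ℕ} (ω : Fin N → Y) : ℝ := sInf ((fun α => α ⬝ᵥ L.cvec) '' L.feasibleN ω)

/-- `α` is an optimizer of `(P_{n,N})`. -/
def IsOptimizer {N : ℕ} (ω : Fin N → Y) (α : Fin n → ℝ) : Prop :=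
  α ∈ L.feasibleN ω ∧ ∀ α' ∈ L.feasibleN ω, α ⬝ᵥ L.cvec ≤ α' ⬝ᵥ L.cvec

/-- `α` is the unique optimizer of `(P_{n,N})`. -/
def IsUniqueOptimizer {N : ℕ} (ω : Fin N → Y) (α : Fin n → ℝ) : Prop :=
  L.IsOptimizer ω α ∧ ∀ α', L.IsOptimizer ω α' → α' = α

/-- The support function `σ_𝒦(δ) = sup_{y ∈ 𝒦} ⟨δ, y⟩`. -/
def support (δ : B) : ℝ := sSup ((fun y => L.pB δ y) '' L.extremal)

variable [MeasurableSpace Y]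

/-- `p(α, ζ) = ℙ[y : σ_𝒦(-A_n α + b) < ⟨-A_n α + b, y⟩ + ζ]`. -/
def tailProb (P : Measure Y) (α : Fin n → ℝ) (ζ : ℝ) : ℝ :=
  P.real {y | L.support (-L.An α + L.b) < L.pB (-L.An α + L.b) y + ζ}

/-- `h` is a tail bound: nonnegative, with `h(α, ε) ≥ sup {ζ ≥ 0 : p(α, ζ) ≤ ε}`.  The level `ε`
ranges over `[0, 1)`: for `ε = 1` the supremum is infinite. -/
def IsTailBound (P : Measure Y) (h : (Fin n → ℝ) → ℝ → ℝ) : Prop :=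
  ∀ α : Fin n → ℝ, ∀ ε : ℝ, 0 ≤ ε → ε < 1 →
    0 ≤ h α ε ∧ ∀ ζ : ℝ, 0 ≤ ζ → L.tailProb P α ζ ≤ ε → ζ ≤ h α ε

/-- `g : ℝ₊ → [0, 1]` is non-decreasing and bounds from below the measure of the open balls
(for the dual norm) centred in `𝒦`. -/
structure IsBallBound (P : Measure Y) (g : ℝ → ℝ) : Prop where
  mono : MonotoneOn g (Set.Ici 0)
  mem_unit : ∀ r, 0 ≤ r → g r ∈ Set.Icc (0 : ℝ) 1
  le_ball : ∀ κ ∈ L.extremal, ∀ r, 0 ≤ r → g r ≤ P.real {y | L.normY (y - κ) < r}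

end Program

/-- The sample size `𝖭(n, ε, β) = min {N : ∑_{i<n} (N choose i) εⁱ (1-ε)^(N-i) ≤ β}`,
with value `⊤` if there is no such `N`. -/
def sampleSize (n : ℕ) (ε β : ℝ) : ℕ∞ :=
  ⨅ N ∈ {N : ℕ | ∑ i ∈ Finset.range n, (N.choose i : ℝ) * ε ^ i * (1 - ε) ^ (N - i) ≤ β}, (N : ℕ∞)

/-- The event `E` has probability at least `q`, in the sense that it contains a measurable event
of probability at least `q` (which is the usual meaning if `E` is measurable). -/
def ProbAtLeast {Ω : Type*} [MeasurableSpace Ω] (μ : Measure Ω) (E : Set Ω) (q : ℝ) : Prop :=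
  ∃ G : Set Ω, MeasurableSet G ∧ G ⊆ E ∧ q ≤ μ.real G

end ScenarioLP

end

/-! The proof joins a deterministic perturbation bound to a probabilistic bound on the risk, the
probability that a fresh constraint is violated.

Deterministic half. A point of the ball `R ≤ θP` whose violation is at most ζ‖y‖ for every y in the
dual cone undercuts `Jn` by at most θ_D ζ (`Regular.Jn_sub_le`): a minimax argument yields y in the
dual cone whose Lagrangian stays above almost `Jn` on the whole ball, and the inf-sup condition then
forces ‖y‖ to be almost at most θ_D. By Krein–Milman the violation need only be controlled on
`extremal` (`le_mul_normY_of_le_extremal`). For (a), risk at most ε bounds the worst violation by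
`h`. For (b), a gap above ε produces an extreme point violated by more than ε/θ_D; a whole ball
around it is still violated, so the risk is at least the value of `g`.

Probabilistic half (`measure_lt_risk_le`). Take first a strictly convex program whose constraint
values have atomless laws. By Helly, at most n active constraints determine the optimizer; filled up
with the constraints of least slack, they form almost surely the unique n-subset that dominates all
other samples. Let W be the probability that a fresh constraint has at most the slack of one of n
samples at their optimizer. Given the samples in an n-subset, the other m are independent, so it
dominates with conditional probability (1-W)^m. Summing over subsets, C(n+m,n) E(1-W)^m = 1 for
every m. These moments determine the law of W, with density n w^(n-1); its truncated moments are
binomial tails, and W dominates the risk (`Atomless.risk_tail_le`).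

The linear scenario program need be neither strictly convex nor atomless. Each constraint is
therefore relaxed by t·u with u uniform, and t‖α‖₂² is added to the cost. As t → 0 the perturbed
optimizers accumulate only at scenario optimizers, and lower semicontinuity of the risk transfers
the bound (`eventually_lt_risk`). -/

namespace ScenarioLP

/-! ### The binomial tail -/

/-- The probability that a binomial variable with parameters `N` and `ε` is smaller than `n`. -/
noncomputable def binomTail (n N : ℕ) (ε : ℝ) : ℝ :=
  ∑ i ∈ Finset.range n, (N.choose i : ℝ) * ε ^ i * (1 - ε) ^ (N - i)

lemma binomTail_eq_sum_bernstein (n N : ℕ) (ε : ℝ) :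
    binomTail n N ε = ∑ i ∈ Finset.range n, (bernsteinPolynomial ℝ N i).eval ε := by
  simp [binomTail, bernsteinPolynomial]

lemma continuous_binomTail (n N : ℕ) : Continuous (binomTail n N) := by
  unfold binomTail; fun_prop

lemma choose_succ_mul_pow (N i : ℕ) (ε : ℝ) :
    ((N + 1).choose (i + 1) : ℝ) * ε ^ (i + 1) * (1 - ε) ^ (N + 1 - (i + 1)) =
      ε * ((N.choose i : ℝ) * ε ^ i * (1 - ε) ^ (N - i)) +
      (1 - ε) * ((N.choose (i + 1) : ℝ) * ε ^ (i + 1) * (1 - ε) ^ (N - (i + 1))) := by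
  rw [Nat.choose_succ_succ, Nat.add_sub_add_right]
  rcases Nat.lt_or_ge i N with h | h
  · obtain ⟨d, rfl⟩ := Nat.exists_eq_add_of_le h
    rw [show i.succ + d - i = d + 1 by omega, show i.succ + d - (i + 1) = d by omega]
    push_cast
    ring
  · rw [Nat.choose_eq_zero_of_lt (show N < i + 1 by omega)]
    push_cast
    ring

/-- One more trial leaves the event "at most n successes" exactly when the first N trials gave n
successes and the new one succeeds. Monotonicity in N follows. -/
lemma binomTail_succ (n N : ℕ) (ε : ℝ) :
    binomTail (n + 1) (N + 1) ε =
      binomTail (n + 1) N ε - ε * ((N.choose n : ℝ) * ε ^ n * (1 - ε) ^ (N - n)) := by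
  induction n with
  | zero => simp [binomTail, pow_succ]; ring
  | succ n ih =>
    have h (M : ℕ) : binomTail (n + 1 + 1) M ε = binomTail (n + 1) M ε +
        (M.choose (n + 1) : ℝ) * ε ^ (n + 1) * (1 - ε) ^ (M - (n + 1)) := by
      simp only [binomTail]
      rw [Finset.sum_range_succ]
    rw [h (N + 1), h N, ih, choose_succ_mul_pow]
    ring

lemma binomTail_antitone {n : ℕ} {ε : ℝ} (h0 : 0 ≤ ε) (h1 : ε ≤ 1) :
    Antitone fun N => binomTail n N ε := by
  refine antitone_nat_of_succ_le fun N => ?_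
  cases n with
  | zero => simp [binomTail]
  | succ n =>
    rw [binomTail_succ]
    have : 0 ≤ 1 - ε := by linarith
    have : 0 ≤ ε * ((N.choose n : ℝ) * ε ^ n * (1 - ε) ^ (N - n)) := by positivity
    linarith

lemma binomTail_zero_right (n N : ℕ) : binomTail (n + 1) N 0 = 1 := by
  rw [binomTail, Finset.sum_range_succ']
  simp

lemma binomTail_one_right (n m : ℕ) : binomTail n (n + m) 1 = 0 := by
  refine Finset.sum_eq_zero fun i hi => ?_
  have : n + m - i ≠ 0 := by have := Finset.mem_range.1 hi; omega
  simp [this]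

lemma binomTail_of_lt {n N : ℕ} (h : N < n) (ε : ℝ) : binomTail n N ε = 1 := by
  have h1 : binomTail n N ε = binomTail (N + 1) N ε := by
    refine (Finset.sum_subset (Finset.range_subset_range.2 h) fun i _ hi => ?_).symm
    have hi' : N < i := by rw [Finset.mem_range] at hi; omega
    simp [Nat.choose_eq_zero_of_lt hi']
  have h2 := add_pow ε (1 - ε) N
  rw [add_sub_cancel, one_pow] at h2
  rw [h1, h2, binomTail]
  exact Finset.sum_congr rfl fun i _ => by ring

/-- Derivatives of consecutive Bernstein polynomials telescope, so only the last term survives. -/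
lemma hasDerivAt_binomTail (n m : ℕ) (ε : ℝ) :
    HasDerivAt (binomTail (n + 1) (n + 1 + m))
      (-(((n + 1 + m).choose (n + 1) : ℝ) * (n + 1) * ε ^ n * (1 - ε) ^ m)) ε := by
  have key (k : ℕ) : ∑ i ∈ Finset.range (k + 1),
      Polynomial.derivative (bernsteinPolynomial ℝ (n + 1 + m) i) =
      -((n + 1 + m : ℕ) : Polynomial ℝ) * bernsteinPolynomial ℝ (n + m) k := by
    induction k with
    | zero => simp [bernsteinPolynomial.derivative_zero, show n + 1 + m - 1 = n + m by omega]
    | succ k ih =>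
      rw [Finset.sum_range_succ, ih, bernsteinPolynomial.derivative_succ,
        show n + 1 + m - 1 = n + m by omega]
      ring
  have h : HasDerivAt (fun x => ∑ i ∈ Finset.range (n + 1),
      (bernsteinPolynomial ℝ (n + 1 + m) i).eval x)
      (∑ i ∈ Finset.range (n + 1),
        (Polynomial.derivative (bernsteinPolynomial ℝ (n + 1 + m) i)).eval ε) ε :=
    HasDerivAt.fun_sum fun i _ => Polynomial.hasDerivAt _ _
  rw [← Polynomial.eval_finsetSum, key] at h
  have hfun : binomTail (n + 1) (n + 1 + m) = fun x => ∑ i ∈ Finset.range (n + 1),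
      (bernsteinPolynomial ℝ (n + 1 + m) i).eval x :=
    funext fun x => binomTail_eq_sum_bernstein _ _ _
  rw [hfun]
  convert h using 1
  have hc : ((n + 1 + m : ℕ) : ℝ) * ((n + m).choose n : ℝ) =
      ((n + 1 + m).choose (n + 1) : ℝ) * (n + 1) := by
    have := Nat.add_one_mul_choose_eq (n + m) n
    rw [show n + m + 1 = n + 1 + m by ring] at this
    exact_mod_cast this
  simp only [bernsteinPolynomial, Polynomial.eval_mul, Polynomial.eval_neg, Polynomial.eval_natCast,
    Polynomial.eval_pow, Polynomial.eval_sub, Polynomial.eval_one, Polynomial.eval_X,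
    Nat.add_sub_cancel_left]
  rw [← hc]
  ring

lemma integral_beta_density (n m : ℕ) (ε : ℝ) :
    ∫ w in ε..1, ((n + 1 + m).choose (n + 1) : ℝ) * (n + 1) * w ^ n * (1 - w) ^ m =
      binomTail (n + 1) (n + 1 + m) ε := by
  have h := intervalIntegral.integral_eq_sub_of_hasDerivAt (a := ε) (b := 1)
    (fun x _ => hasDerivAt_binomTail n m x) (Continuous.intervalIntegrable (by fun_prop) _ _)
  rw [binomTail_one_right, intervalIntegral.integral_neg] at h
  linarith

/-! ### The moment problem on the unit interval -/

lemma integral_polynomial_eq_of_moments {μ ν : Measure ℝ} [IsFiniteMeasure μ] [IsFiniteMeasure ν]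
    (hμ : ∀ᵐ w ∂μ, w ∈ Set.Icc (0 : ℝ) 1) (hν : ∀ᵐ w ∂ν, w ∈ Set.Icc (0 : ℝ) 1)
    (h : ∀ m : ℕ, ∫ w, (1 - w) ^ m ∂μ = ∫ w, (1 - w) ^ m ∂ν) (p : Polynomial ℝ) :
    ∫ w, p.eval (1 - w) ∂μ = ∫ w, p.eval (1 - w) ∂ν := by
  have hint {ρ : Measure ℝ} [IsFiniteMeasure ρ] (hρ : ∀ᵐ w ∂ρ, w ∈ Set.Icc (0 : ℝ) 1) (m : ℕ) :
      Integrable (fun w => (1 - w) ^ m) ρ := by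
    refine Integrable.of_bound (by fun_prop) 1 ?_
    filter_upwards [hρ] with w hw
    rw [norm_pow, Real.norm_eq_abs, abs_of_nonneg (by linarith [hw.2])]
    exact pow_le_one₀ (by linarith [hw.2]) (by linarith [hw.1])
  simp only [Polynomial.eval_eq_sum_range]
  rw [integral_finsetSum _ fun i _ => (hint hμ i).const_mul _,
    integral_finsetSum _ fun i _ => (hint hν i).const_mul _]
  simp_rw [integral_const_mul, h]

/-- Weierstrass approximation on the unit interval. Moments of 1 - w are used because (1 - w)^m is
the probability that m independent samples all avoid a set of measure w. -/
lemma ext_of_moments {μ ν : Measure ℝ} [IsProbabilityMeasure μ] [IsProbabilityMeasure ν]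
    (hμ : ∀ᵐ w ∂μ, w ∈ Set.Icc (0 : ℝ) 1) (hν : ∀ᵐ w ∂ν, w ∈ Set.Icc (0 : ℝ) 1)
    (h : ∀ m : ℕ, ∫ w, (1 - w) ^ m ∂μ = ∫ w, (1 - w) ^ m ∂ν) : μ = ν := by
  refine ext_of_forall_integral_eq_of_IsFiniteMeasure fun f => ?_
  refine eq_of_forall_dist_le fun δ hδ => ?_
  obtain ⟨p, hp⟩ := exists_polynomial_near_of_continuousOn 0 1 (fun x => f (1 - x))
    (by fun_prop) (δ / 2) (by linarith)
  have happrox {ρ : Measure ℝ} [IsProbabilityMeasure ρ] (hρ : ∀ᵐ w ∂ρ, w ∈ Set.Icc (0 : ℝ) 1) :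
      dist (∫ w, f w ∂ρ) (∫ w, p.eval (1 - w) ∂ρ) ≤ δ / 2 := by
    have hbound : ∀ᵐ w ∂ρ, ‖f w - p.eval (1 - w)‖ ≤ δ / 2 := by
      filter_upwards [hρ] with w hw
      have := hp (1 - w) ⟨by linarith [hw.2], by linarith [hw.1]⟩
      rw [sub_sub_cancel, abs_sub_comm] at this
      exact this.le
    have hcont : Continuous fun w : ℝ => p.eval (1 - w) := by fun_prop
    have hfi : Integrable (fun w => f w) ρ := f.integrable ρ
    have hd : Integrable (fun w => f w - p.eval (1 - w)) ρ :=
      Integrable.of_bound (by fun_prop) (δ / 2) hbound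
    have hpi : Integrable (fun w => p.eval (1 - w)) ρ := by
      exact (hfi.sub hd).congr (.of_forall fun w => by simp)
    rw [dist_eq_norm, ← integral_sub hfi hpi]
    simpa using norm_integral_le_of_norm_le_const hbound
  have h1 := happrox hμ
  have h2 := happrox hν
  rw [integral_polynomial_eq_of_moments hμ hν h p] at h1
  have := dist_triangle_right (∫ w, f w ∂μ) (∫ w, f w ∂ν) (∫ w, p.eval (1 - w) ∂ν)
  linarith

/-- The law on `(0, 1]` with density `(n + 1) wⁿ`. -/
noncomputable def betaLaw (n : ℕ) : Measure ℝ :=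
  (volume.restrict (Set.Ioc 0 1)).withDensity fun w => ENNReal.ofReal ((n + 1) * w ^ n)

lemma setIntegral_betaLaw (n m : ℕ) {ε : ℝ} (h0 : 0 ≤ ε) (h1 : ε ≤ 1) :
    ((n + 1 + m).choose (n + 1) : ℝ) * ∫ w in Set.Ioi ε, (1 - w) ^ m ∂betaLaw n =
      binomTail (n + 1) (n + 1 + m) ε := by
  rw [betaLaw, restrict_withDensity measurableSet_Ioi,
    Measure.restrict_restrict measurableSet_Ioi,
    show Set.Ioi ε ∩ Set.Ioc 0 1 = Set.Ioc ε 1 by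
      ext x; simp only [Set.mem_inter_iff, Set.mem_Ioi, Set.mem_Ioc]
      exact ⟨fun h => ⟨h.1, h.2.2⟩, fun h => ⟨h.1, h0.trans_lt h.1, h.2⟩⟩,
    integral_withDensity_eq_integral_toReal_smul (by fun_prop) (by simp),
    ← integral_beta_density, intervalIntegral.integral_of_le h1, ← integral_const_mul]
  refine setIntegral_congr_fun measurableSet_Ioc fun w hw => ?_
  have : 0 ≤ w := h0.trans hw.1.le
  simp only [smul_eq_mul]
  rw [ENNReal.toReal_ofReal (by positivity)]
  ring

lemma betaLaw_mem_Ioc (n : ℕ) : ∀ᵐ w ∂betaLaw n, w ∈ Set.Ioc (0 : ℝ) 1 :=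
  (withDensity_absolutelyContinuous _ _).ae_le (ae_restrict_mem measurableSet_Ioc)

lemma integral_betaLaw (n m : ℕ) :
    ((n + 1 + m).choose (n + 1) : ℝ) * ∫ w, (1 - w) ^ m ∂betaLaw n = 1 := by
  have h := setIntegral_betaLaw n m le_rfl zero_le_one
  rw [binomTail_zero_right, setIntegral_eq_integral_of_ae_compl_eq_zero] at h
  · exact h
  · filter_upwards [betaLaw_mem_Ioc n] with w hw hw'
    exact absurd hw.1 hw'

instance (n : ℕ) : IsProbabilityMeasure (betaLaw n) := by
  have h := integral_betaLaw n 0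
  simp only [add_zero, Nat.choose_self, Nat.cast_one, pow_zero, integral_const, smul_eq_mul,
    mul_one, one_mul] at h
  refine ⟨?_⟩
  rw [measureReal_def] at h
  rw [← ENNReal.toReal_eq_one_iff]
  exact h

/-- The full moments identify the law of `W` as `betaLaw n`, under which the truncated moments are
explicit. -/
lemma setIntegral_eq_binomTail_of_moments {Ω : Type*} [MeasurableSpace Ω] {μ : Measure Ω}
    [IsProbabilityMeasure μ] {W : Ω → ℝ} (hW : Measurable W) (hW01 : ∀ x, W x ∈ Set.Icc (0 : ℝ) 1)
    {n : ℕ} (h : ∀ m : ℕ, ((n + 1 + m).choose (n + 1) : ℝ) * ∫ x, (1 - W x) ^ m ∂μ = 1)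
    {ε : ℝ} (h0 : 0 ≤ ε) (h1 : ε ≤ 1) (m : ℕ) :
    ((n + 1 + m).choose (n + 1) : ℝ) * ∫ x in {x | ε < W x}, (1 - W x) ^ m ∂μ =
      binomTail (n + 1) (n + 1 + m) ε := by
  have : IsProbabilityMeasure (μ.map W) := Measure.isProbabilityMeasure_map hW.aemeasurable
  have hmap : μ.map W = betaLaw n := by
    refine ext_of_moments ?_ ((betaLaw_mem_Ioc n).mono fun w hw => Set.Ioc_subset_Icc_self hw) ?_
    · exact (ae_map_iff hW.aemeasurable measurableSet_Icc).2 (.of_forall hW01)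
    · intro m
      rw [integral_map hW.aemeasurable (by fun_prop)]
      have hpos : (0 : ℝ) < ((n + 1 + m).choose (n + 1) : ℝ) := by
        exact_mod_cast Nat.choose_pos (by omega)
      exact mul_left_cancel₀ hpos.ne' ((h m).trans (integral_betaLaw n m).symm)
  rw [← setIntegral_betaLaw n m h0 h1, ← hmap,
    setIntegral_map measurableSet_Ioi (by fun_prop) hW.aemeasurable]
  rfl

/-! ### Sampled convex programs with a unique optimizer -/

/-- A convex program over a compact convex set `D ⊆ ℝⁿ`, with a strictly convex quadratic
objective and one affine constraint `(α₀ - α) ⬝ a z ≤ |s z|`, satisfied by `α₀ ∈ D`, for every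
`z : Z`. -/
structure SampledProgram (Z : Type*) [MeasurableSpace Z] (n : ℕ) where
  D : Set (Fin n → ℝ)
  isCompact_D : IsCompact D
  convex_D : Convex ℝ D
  α₀ : Fin n → ℝ
  α₀_mem : α₀ ∈ D
  a : Z → Fin n → ℝ
  measurable_a : Measurable a
  s : Z → ℝ
  measurable_s : Measurable s
  c : Fin n → ℝ
  t : ℝ
  t_pos : 0 < t

namespace SampledProgram

variable {Z : Type*} [MeasurableSpace Z] {n : ℕ} (M : SampledProgram Z n)

/-- The constraint function. -/
def f (z : Z) (α : Fin n → ℝ) : ℝ := (M.α₀ - α) ⬝ᵥ M.a z - |M.s z|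

/-- The objective function. -/
def obj (α : Fin n → ℝ) : ℝ := α ⬝ᵥ M.c + M.t * (α ⬝ᵥ α)

/-- The points of `D` that satisfy the constraints in `S`. -/
def feas (S : Set Z) : Set (Fin n → ℝ) := {α | α ∈ M.D ∧ ∀ z ∈ S, M.f z α ≤ 0}

lemma continuous_obj : Continuous M.obj := by unfold obj; fun_prop

lemma continuous_f (z : Z) : Continuous (M.f z) := by unfold f; fun_prop

lemma f_combo (z : Z) (α β : Fin n → ℝ) (r : ℝ) :
    M.f z ((1 - r) • α + r • β) = (1 - r) * M.f z α + r * M.f z β := by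
  simp only [f, sub_dotProduct, add_dotProduct, smul_dotProduct, smul_eq_mul]
  ring

lemma obj_combo (α β : Fin n → ℝ) (r : ℝ) :
    M.obj ((1 - r) • α + r • β) =
      (1 - r) * M.obj α + r * M.obj β - M.t * (r * (1 - r)) * ((α - β) ⬝ᵥ (α - β)) := by
  simp only [obj, sub_dotProduct, add_dotProduct, smul_dotProduct, smul_eq_mul, dotProduct_add,
    dotProduct_sub, dotProduct_smul, dotProduct_comm β α]
  ring

lemma obj_combo_le (α β : Fin n → ℝ) {r : ℝ} (h0 : 0 ≤ r) (h1 : r ≤ 1) :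
    M.obj ((1 - r) • α + r • β) ≤ (1 - r) * M.obj α + r * M.obj β := by
  rw [obj_combo]
  have h2 : 0 ≤ 1 - r := by linarith
  have h3 : 0 ≤ (α - β) ⬝ᵥ (α - β) := by
    rw [dotProduct]; exact Finset.sum_nonneg fun i _ => mul_self_nonneg _
  have := mul_nonneg (mul_nonneg M.t_pos.le (mul_nonneg h0 h2)) h3
  linarith

lemma combo_mem_feas {S : Set Z} {α β : Fin n → ℝ} (hα : α ∈ M.feas S) (hβ : β ∈ M.feas S)
    {r : ℝ} (h0 : 0 ≤ r) (h1 : r ≤ 1) : (1 - r) • α + r • β ∈ M.feas S := by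
  have h2 : 0 ≤ 1 - r := by linarith
  refine ⟨M.convex_D hα.1 hβ.1 h2 h0 (by ring), fun z hz => ?_⟩
  rw [f_combo]
  have := mul_nonpos_of_nonneg_of_nonpos h2 (hα.2 z hz)
  have := mul_nonpos_of_nonneg_of_nonpos h0 (hβ.2 z hz)
  linarith

lemma α₀_mem_feas (S : Set Z) : M.α₀ ∈ M.feas S :=
  ⟨M.α₀_mem, fun z _ => by simp [f]⟩

lemma feas_anti {S T : Set Z} (h : S ⊆ T) : M.feas T ⊆ M.feas S :=
  fun _ hα => ⟨hα.1, fun z hz => hα.2 z (h hz)⟩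

lemma isCompact_feas (S : Set Z) : IsCompact (M.feas S) := by
  have : M.feas S = M.D ∩ ⋂ z ∈ S, {α | M.f z α ≤ 0} := by ext; simp [feas]
  rw [this]
  exact M.isCompact_D.inter_right
    (isClosed_biInter fun z _ => isClosed_le (M.continuous_f z) continuous_const)

lemma exists_opt (S : Set Z) : ∃ α ∈ M.feas S, ∀ β ∈ M.feas S, M.obj α ≤ M.obj β := by
  obtain ⟨α, hα, h⟩ := (M.isCompact_feas S).exists_isMinOn ⟨_, M.α₀_mem_feas S⟩
    M.continuous_obj.continuousOn
  exact ⟨α, hα, fun β hβ => h hβ⟩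

/-- The optimizer under the constraints in `S`. -/
noncomputable def opt (S : Set Z) : Fin n → ℝ := (M.exists_opt S).choose

lemma opt_mem (S : Set Z) : M.opt S ∈ M.feas S := (M.exists_opt S).choose_spec.1

lemma obj_opt_le {S : Set Z} {β : Fin n → ℝ} (hβ : β ∈ M.feas S) : M.obj (M.opt S) ≤ M.obj β :=
  (M.exists_opt S).choose_spec.2 β hβ

/-- By strict convexity, the midpoint of two distinct optimizers would be strictly better. -/
lemma eq_opt {S : Set Z} {α : Fin n → ℝ} (hα : α ∈ M.feas S) (h : M.obj α ≤ M.obj (M.opt S)) :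
    α = M.opt S := by
  by_contra hne
  have h1 := M.obj_opt_le (M.combo_mem_feas hα (M.opt_mem S) (r := 1 / 2) (by norm_num)
    (by norm_num))
  rw [obj_combo] at h1
  have h2 : 0 < (α - M.opt S) ⬝ᵥ (α - M.opt S) := by
    refine lt_of_le_of_ne ?_ fun h0 => hne (sub_eq_zero.1 (dotProduct_self_eq_zero.1 h0.symm))
    rw [dotProduct]; exact Finset.sum_nonneg fun i _ => mul_self_nonneg _
  have := mul_pos M.t_pos h2
  nlinarith

lemma opt_eq_of_subset {S T : Set Z} (h : S ⊆ T) (hT : M.opt S ∈ M.feas T) :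
    M.opt S = M.opt T :=
  M.eq_opt hT (M.obj_opt_le (M.feas_anti h (M.opt_mem T)))

/-- The optimizer is determined by at most `n` active constraints. -/
lemma exists_active_basis {ι : Type*} [Fintype ι] (z : ι → Z) :
    ∃ I : Finset ι, I.card ≤ n ∧ (∀ i ∈ I, M.f (z i) (M.opt (Set.range z)) = 0) ∧
      M.opt (z '' I) = M.opt (Set.range z) := by
  classical
  set α := M.opt (Set.range z) with hα
  have hmem := M.opt_mem (Set.range z)
  rw [← hα] at hmem
  by_contra! hcon
  let A : Finset ι := Finset.univ.filter fun i => M.f (z i) α = 0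
  -- Helly's theorem is applied to the active constraint sets together with the set `none` of
  -- strictly better points. If no small basis existed, any n + 1 of these sets would meet.
  let F : Option ι → Set (Fin n → ℝ) := fun o =>
    o.elim {β | β ∈ M.D ∧ M.obj β < M.obj α} fun i => {β | β ∈ M.D ∧ M.f (z i) β ≤ 0}
  have hconv : ∀ o ∈ Finset.insertNone A, Convex ℝ (F o) := by
    intro o _
    have key (g : (Fin n → ℝ) → ℝ) (hg : ∀ x y : Fin n → ℝ, ∀ r : ℝ, 0 ≤ r → r ≤ 1 →
        g ((1 - r) • x + r • y) ≤ (1 - r) * g x + r * g y) : ConvexOn ℝ M.D g := by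
      refine ⟨M.convex_D, fun x _ y _ p q _ hq hpq => ?_⟩
      obtain rfl : p = 1 - q := by linarith
      exact hg x y q hq (by linarith)
    cases o with
    | none => exact (key M.obj fun x y r => M.obj_combo_le x y).convex_lt _
    | some i => exact (key (M.f (z i)) fun x y r _ _ => (M.f_combo _ x y r).le).convex_le _
  have hinter : ∀ J ⊆ Finset.insertNone A, J.card ≤ Module.finrank ℝ (Fin n → ℝ) + 1 →
      (⋂ o ∈ J, F o).Nonempty := by
    intro J hJ hcard
    rw [Module.finrank_fin_fun] at hcard
    by_cases hnone : none ∈ J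
    · let I : Finset ι := Finset.eraseNone J
      have hI : I.card ≤ n := by
        have : J = insert none (I.map Function.Embedding.some) := by
          ext o; cases o <;> simp [I, hnone]
        rw [this, Finset.card_insert_of_notMem (by simp), Finset.card_map] at hcard
        omega
      have hIA : ∀ i ∈ I, M.f (z i) α = 0 := fun i hi => by
        have := hJ (Finset.mem_eraseNone.1 hi)
        simpa [A] using this
      -- Besides `none` there are at most n active constraints. By assumption their optimizer
      -- differs from `α`, hence is strictly better.
      have hne := hcon I hI hIA
      have hsub : z '' I ⊆ Set.range z := Set.image_subset_range _ _
      have hlt : M.obj (M.opt (z '' I)) < M.obj α := by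
        by_contra! hle
        exact hne (M.eq_opt (M.feas_anti hsub hmem) hle).symm
      refine ⟨M.opt (z '' I), Set.mem_iInter₂.2 fun o ho => ?_⟩
      cases o with
      | none => exact ⟨(M.opt_mem _).1, hlt⟩
      | some i =>
        exact ⟨(M.opt_mem _).1, (M.opt_mem _).2 _ ⟨i, Finset.mem_eraseNone.2 ho, rfl⟩⟩
    · refine ⟨α, Set.mem_iInter₂.2 fun o ho => ?_⟩
      cases o with
      | none => exact absurd ho hnone
      | some i => exact ⟨hmem.1, hmem.2 _ ⟨i, rfl⟩⟩
  obtain ⟨β, hβ⟩ := Convex.helly_theorem' hconv hinter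
  rw [Set.mem_iInter₂] at hβ
  have hβ0 : β ∈ M.D ∧ M.obj β < M.obj α := hβ none (by simp)
  have hβA (i : ι) (hi : M.f (z i) α = 0) : M.f (z i) β ≤ 0 :=
    (hβ (some i) (by simp [A, hi])).2
  -- A short step from `α` towards `β` keeps the inactive constraints satisfied by continuity and
  -- the active ones by affinity, yet improves the objective: a contradiction.
  have hev : ∀ᶠ r : ℝ in nhdsWithin 0 (Set.Ioi 0), ∀ i,
      M.f (z i) ((1 - r) • α + r • β) ≤ 0 := by
    rw [Filter.eventually_all]
    intro i
    simp only [f_combo]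
    rcases (hmem.2 _ ⟨i, rfl⟩ : M.f (z i) α ≤ 0).lt_or_eq with h | h
    · have hc : Filter.Tendsto (fun r : ℝ => (1 - r) * M.f (z i) α + r * M.f (z i) β)
          (nhdsWithin 0 (Set.Ioi 0)) (nhds ((1 - 0) * M.f (z i) α + 0 * M.f (z i) β)) :=
        (Continuous.tendsto (by fun_prop) 0).mono_left nhdsWithin_le_nhds
      filter_upwards [hc.eventually_lt_const (by simpa using h)] with r hr using hr.le
    · filter_upwards [self_mem_nhdsWithin] with r hr
      rw [h, mul_zero, zero_add]
      exact mul_nonpos_of_nonneg_of_nonpos (le_of_lt hr) (hβA i h)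
  have hlt1 : ∀ᶠ r : ℝ in nhdsWithin 0 (Set.Ioi 0), r < 1 :=
    mem_nhdsWithin_of_mem_nhds (Iio_mem_nhds one_pos)
  obtain ⟨r, hr, hr1, hr0⟩ := (hev.and (hlt1.and self_mem_nhdsWithin)).exists
  have hr0 : 0 < r := hr0
  have h1 := M.obj_opt_le (S := Set.range z) (β := (1 - r) • α + r • β)
    ⟨M.convex_D hmem.1 hβ0.1 (by linarith) hr0.le (by ring), by rintro _ ⟨i, rfl⟩; exact hr i⟩
  have h2 := M.obj_combo_le α β hr0.le hr1.le
  rw [← hα] at h1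
  nlinarith [hβ0.2]

/-! ### Measurability of the optimizer -/

/-- In the space of constraint coefficients the set is the projection of a closed set along the
compact `A`, hence closed; it is pulled back by a measurable map. -/
lemma measurableSet_exists_feasible {ι : Type*} [Fintype ι] (I : Set ι) {A : Set (Fin n → ℝ)}
    (hA : IsCompact A) :
    MeasurableSet {z : ι → Z | ∃ α ∈ A, ∀ i ∈ I, M.f (z i) α ≤ 0} := by
  let T : Set (ι → (Fin n → ℝ) × ℝ) :=
    {p | ∃ α ∈ A, ∀ i ∈ I, (M.α₀ - α) ⬝ᵥ (p i).1 - |(p i).2| ≤ 0}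
  have hT : IsClosed T := by
    have : CompactSpace A := isCompact_iff_compactSpace.1 hA
    let U : Set (A × (ι → (Fin n → ℝ) × ℝ)) :=
      {q | ∀ i ∈ I, (M.α₀ - (q.1 : Fin n → ℝ)) ⬝ᵥ (q.2 i).1 - |(q.2 i).2| ≤ 0}
    have hU : IsClosed U := by
      have : U = ⋂ i ∈ I, {q | (M.α₀ - (q.1 : Fin n → ℝ)) ⬝ᵥ (q.2 i).1 - |(q.2 i).2| ≤ 0} := by
        ext; simp [U]
      rw [this]
      exact isClosed_biInter fun i _ => isClosed_le (by fun_prop) continuous_const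
    have hTU : T = Prod.snd '' U := by
      ext p
      constructor
      · rintro ⟨α, hα, h⟩
        exact ⟨(⟨α, hα⟩, p), h, rfl⟩
      · rintro ⟨⟨α, q⟩, h, rfl⟩
        exact ⟨α, α.2, h⟩
    rw [hTU]
    exact isClosedMap_snd_of_compactSpace _ hU
  have hmeas : Measurable fun (z : ι → Z) (i : ι) => (M.a (z i), M.s (z i)) :=
    measurable_pi_lambda _ fun i => (M.measurable_a.comp (measurable_pi_apply i)).prodMk
      (M.measurable_s.comp (measurable_pi_apply i))
  exact hmeas hT.measurableSet

lemma measurable_opt {ι : Type*} [Fintype ι] (I : Set ι) :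
    Measurable fun z : ι → Z => M.opt (z '' I) := by
  refine measurable_of_isClosed fun A hA => ?_
  have hle (q : ℚ) : IsClosed {α | M.obj α ≤ q} := isClosed_le M.continuous_obj continuous_const
  -- By uniqueness, the optimizer lies in `A` iff the minimum over feasible points in `A` is the
  -- overall minimum. Rational levels `q` test this with countably many conditions.
  have heq : (fun z : ι → Z => M.opt (z '' I)) ⁻¹' A =
      ⋂ q : ℚ, {z | ∃ α ∈ M.D ∩ {α | M.obj α ≤ q}, ∀ i ∈ I, M.f (z i) α ≤ 0}ᶜ ∪
        {z | ∃ α ∈ M.D ∩ ({α | M.obj α ≤ q} ∩ A), ∀ i ∈ I, M.f (z i) α ≤ 0} := by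
    ext z
    simp only [Set.mem_preimage, Set.mem_iInter, Set.mem_union, Set.mem_compl_iff,
      Set.mem_ofPred_eq]
    have hfeas {α : Fin n → ℝ} (hD : α ∈ M.D) (h : ∀ i ∈ I, M.f (z i) α ≤ 0) :
        α ∈ M.feas (z '' I) := ⟨hD, by rintro _ ⟨i, hi, rfl⟩; exact h i hi⟩
    have hopt := M.opt_mem (z '' I)
    constructor
    · intro hz q
      refine or_iff_not_imp_left.2 fun h => ?_
      rw [not_not] at h
      obtain ⟨α, ⟨hD, hq⟩, hα⟩ := h
      exact ⟨M.opt (z '' I), ⟨hopt.1, (M.obj_opt_le (hfeas hD hα)).trans hq, hz⟩,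
        fun i hi => hopt.2 _ ⟨i, hi, rfl⟩⟩
    · intro h
      have hcpt : IsCompact (M.feas (z '' I) ∩ A) := (M.isCompact_feas _).inter_right hA
      have hex (q : ℚ) (hq : M.obj (M.opt (z '' I)) ≤ q) :
          ∃ α ∈ M.feas (z '' I) ∩ A, M.obj α ≤ q := by
        rcases h q with h | ⟨α, ⟨hD, hle, hαA⟩, hα⟩
        · exact absurd ⟨_, ⟨hopt.1, hq⟩, fun i hi => hopt.2 _ ⟨i, hi, rfl⟩⟩ h
        · exact ⟨α, ⟨hfeas hD hα, hαA⟩, hle⟩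
      have hne : (M.feas (z '' I) ∩ A).Nonempty := by
        obtain ⟨q, hq⟩ := exists_rat_gt (M.obj (M.opt (z '' I)))
        obtain ⟨α, hα, _⟩ := hex q hq.le
        exact ⟨α, hα⟩
      obtain ⟨α, hα, hmin⟩ := hcpt.exists_isMinOn hne M.continuous_obj.continuousOn
      have : M.obj α ≤ M.obj (M.opt (z '' I)) := by
        by_contra! hlt
        obtain ⟨q, hq1, hq2⟩ := exists_rat_btwn hlt
        obtain ⟨β, hβ, hβq⟩ := hex q hq1.le
        exact absurd ((hmin hβ : M.obj α ≤ M.obj β).trans hβq) (not_le.2 hq2)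
      rw [← M.eq_opt hα.1 this]
      exact hα.2
  rw [heq]
  refine MeasurableSet.iInter fun q => MeasurableSet.union (MeasurableSet.compl ?_) ?_
  · exact M.measurableSet_exists_feasible I (M.isCompact_D.inter_right (hle q))
  · exact M.measurableSet_exists_feasible I (M.isCompact_D.inter_right ((hle q).inter hA))

end SampledProgram

/-! ### Dominating subsets of samples and the law of the risk -/

lemma exists_top_subset {ι : Type*} [Fintype ι] {φ : ι → ℝ} {I : Finset ι}
    (h1 : ∀ i ∈ I, ∀ j ∉ I, φ j < φ i) (h2 : ∀ j ∉ I, ∀ j', j' ≠ j → φ j ≠ φ j')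
    {k : ℕ} (hk : I.card ≤ k) (hk' : k ≤ Fintype.card ι) :
    ∃ T : Finset ι, I ⊆ T ∧ T.card = k ∧ ∀ i ∈ T, ∀ j ∉ T, φ j < φ i := by
  classical
  induction k, hk using Nat.le_induction with
  | base => exact ⟨I, subset_rfl, rfl, h1⟩
  | succ k hk ih =>
    obtain ⟨T, hIT, hcard, hT⟩ := ih (by omega)
    have hne : Tᶜ.Nonempty := by
      rw [← Finset.card_pos, Finset.card_compl]; omega
    -- The greedy choice adds the largest remaining value; absence of ties makes the inequalities
    -- strict.
    obtain ⟨l, hl, hmax⟩ := Tᶜ.exists_max_image φ hne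
    rw [Finset.mem_compl] at hl
    refine ⟨insert l T, hIT.trans (Finset.subset_insert _ _), ?_, ?_⟩
    · rw [Finset.card_insert_of_notMem hl, hcard]
    · intro i hi j hj
      rw [Finset.mem_insert, not_or] at hj
      rcases Finset.mem_insert.1 hi with rfl | hi
      · exact lt_of_le_of_ne (hmax j (Finset.mem_compl.2 hj.2))
          (h2 j (fun h => hj.2 (hIT h)) _ (Ne.symm hj.1))
      · exact hT i hi j hj.2

/-- Splitting the coordinates in a product of equal probability spaces. -/
lemma measurePreserving_split {Z : Type*} [MeasurableSpace Z] (Q : Measure Z)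
    [IsProbabilityMeasure Q] {ι κ τ : Type*} [Fintype ι] [Fintype κ] [Fintype τ] (e : ι ⊕ κ ≃ τ) :
    MeasurePreserving (fun z : τ → Z => (fun i => z (e (.inl i)), fun j => z (e (.inr j))))
      (Measure.pi fun _ => Q) ((Measure.pi fun _ => Q).prod (Measure.pi fun _ => Q)) := by
  have h1 := (measurePreserving_piCongrLeft (fun _ : τ => Q) e).symm
  have h2 := measurePreserving_sumPiEquivProdPi (fun _ : ι ⊕ κ => Q)
  have h := h2.comp h1
  have hfun : (fun z : τ → Z => (fun i => z (e (.inl i)), fun j => z (e (.inr j)))) =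
      MeasurableEquiv.sumPiEquivProdPi (fun _ : ι ⊕ κ => Z) ∘
        (MeasurableEquiv.piCongrLeft (fun _ : τ => Z) e).symm := rfl
  rw [hfun]
  exact h

namespace SampledProgram

variable {Z : Type*} [MeasurableSpace Z] {n : ℕ} (M : SampledProgram Z n)

lemma measurable_f_comp {Ω : Type*} [MeasurableSpace Ω] {g : Ω → Z} {h : Ω → Fin n → ℝ}
    (hg : Measurable g) (hh : Measurable h) : Measurable fun ω => M.f (g ω) (h ω) := by
  have ha : Measurable fun ω => M.a (g ω) := M.measurable_a.comp hg
  have hs : Measurable fun ω => M.s (g ω) := M.measurable_s.comp hg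
  simp only [f, dotProduct, Pi.sub_apply]
  fun_prop

lemma measurable_opt_range {ι : Type*} [Fintype ι] :
    Measurable fun z : ι → Z => M.opt (Set.range z) := by
  simpa using M.measurable_opt (ι := ι) Set.univ

/-- The constraint functions have atomless laws. -/
def Atomless (Q : Measure Z) : Prop := ∀ α r, Q {z | M.f z α = r} = 0

variable {M} {Q : Measure Z} [IsProbabilityMeasure Q]

/-- By Fubini: once the other samples are fixed, sample `j` hits a prescribed value with probability
zero. -/
lemma Atomless.ae_ne (hQ : M.Atomless Q) {N : ℕ} (j : Fin (N + 1))
    {H : (Fin N → Z) → Fin n → ℝ} (hH : Measurable H) {r : (Fin N → Z) → ℝ} (hr : Measurable r) :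
    ∀ᵐ z ∂(Measure.pi fun _ : Fin (N + 1) => Q),
      M.f (z j) (H (j.removeNth z)) ≠ r (j.removeNth z) := by
  have hs : MeasurableSet {p : Z × (Fin N → Z) | M.f p.1 (H p.2) = r p.2} :=
    measurableSet_eq_fun (M.measurable_f_comp measurable_fst (hH.comp measurable_snd))
      (hr.comp measurable_snd)
  have hmp := measurePreserving_piFinSuccAbove (fun _ : Fin (N + 1) => Q) j
  have h0 : (Q.prod (Measure.pi fun _ : Fin N => Q)) {p | M.f p.1 (H p.2) = r p.2} = 0 := by
    rw [Measure.prod_apply_symm hs]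
    refine (lintegral_congr fun w => ?_).trans lintegral_zero
    exact hQ (H w) (r w)
  have := hmp.measure_preimage hs.nullMeasurableSet
  rw [h0] at this
  simp only [ne_eq, ae_iff, not_not]
  exact this

/-- For j ∉ I the optimizer for `I` is a function of the samples other than `j`, so `ae_ne` applies;
only finitely many exceptional sets occur. -/
lemma Atomless.ae_generic (hQ : M.Atomless Q) (N : ℕ) :
    ∀ᵐ z ∂(Measure.pi fun _ : Fin N => Q), ∀ I : Finset (Fin N), ∀ j ∉ I,
      M.f (z j) (M.opt (z '' I)) ≠ 0 ∧
        ∀ j', j' ≠ j → M.f (z j) (M.opt (z '' I)) ≠ M.f (z j') (M.opt (z '' I)) := by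
  cases N with
  | zero => exact .of_forall fun z I j => j.elim0
  | succ N =>
    rw [ae_all_iff]; intro I
    rw [ae_all_iff]; intro j
    by_cases hj : j ∈ I
    · exact .of_forall fun z h => absurd hj h
    have himg (z : Fin (N + 1) → Z) :
        z '' I = j.removeNth z '' (j.succAbove ⁻¹' I) := by
      ext x
      constructor
      · rintro ⟨i, hi, rfl⟩
        obtain ⟨l, rfl⟩ := Fin.exists_succAbove_eq (x := i) (y := j) (fun h => hj (h ▸ hi))
        exact ⟨l, hi, rfl⟩
      · rintro ⟨l, hl, rfl⟩
        exact ⟨_, hl, rfl⟩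
    have hopt := M.measurable_opt (ι := Fin N) (j.succAbove ⁻¹' (I : Set (Fin (N + 1))))
    have h1 := hQ.ae_ne j hopt (measurable_const (a := (0 : ℝ)))
    have h2 : ∀ l : Fin N, ∀ᵐ z ∂(Measure.pi fun _ : Fin (N + 1) => Q), _ := fun l =>
      hQ.ae_ne j hopt (M.measurable_f_comp (measurable_pi_apply l) hopt)
    filter_upwards [h1, ae_all_iff.2 h2] with z hz1 hz2 _
    simp only [himg]
    refine ⟨hz1, fun j' hj' => ?_⟩
    obtain ⟨l, rfl⟩ := Fin.exists_succAbove_eq hj'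
    exact hz2 l

variable (M)

/-- All constraints outside `I` have more slack than those of `I` at the optimizer for `I`. -/
def Dominates {ι : Type*} (I : Finset ι) (z : ι → Z) : Prop :=
  ∀ i ∈ I, ∀ j ∉ I, M.f (z j) (M.opt (z '' I)) < M.f (z i) (M.opt (z '' I))

variable {M}

lemma Dominates.opt_eq {ι : Type*} {I : Finset ι} {z : ι → Z} (h : M.Dominates I z)
    (hI : I.Nonempty) : M.opt (z '' I) = M.opt (Set.range z) := by
  refine M.opt_eq_of_subset (Set.image_subset_range _ _) ⟨(M.opt_mem _).1, ?_⟩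
  rintro _ ⟨j, rfl⟩
  by_cases hj : j ∈ I
  · exact (M.opt_mem _).2 _ ⟨j, hj, rfl⟩
  · obtain ⟨i, hi⟩ := hI
    exact (h i hi j hj).le.trans ((M.opt_mem _).2 _ ⟨i, hi, rfl⟩)

/-- Both subsets yield the optimizer of the full program, so an index of I \ J and one of J \ I
would each have strictly less slack than the other at the same point. -/
lemma Dominates.unique {ι : Type*} {I J : Finset ι} {z : ι → Z} (hI : M.Dominates I z)
    (hJ : M.Dominates J z) (hI0 : I.Nonempty) (hcard : I.card = J.card) : I = J := by
  classical
  have hJ0 : J.Nonempty := by rw [← Finset.card_pos, ← hcard, Finset.card_pos]; exact hI0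
  by_contra hne
  have h1 : (I \ J).Nonempty := by
    rw [Finset.sdiff_nonempty]
    exact fun h => hne (Finset.eq_of_subset_of_card_le h hcard.ge)
  have h2 : (J \ I).Nonempty := by
    rw [Finset.sdiff_nonempty]
    exact fun h => hne (Finset.eq_of_subset_of_card_le h hcard.le).symm
  obtain ⟨i, hi⟩ := h1
  obtain ⟨j, hj⟩ := h2
  rw [Finset.mem_sdiff] at hi hj
  have h3 := hI i hi.1 j hj.2
  have h4 := hJ j hj.1 i hi.2
  rw [hI.opt_eq hI0] at h3
  rw [hJ.opt_eq hJ0] at h4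
  exact lt_asymm h3 h4

/-- The active basis may have fewer than n elements. Adding the constraints of least slack brings it
to size n without changing the optimizer, which already satisfies them. -/
lemma Atomless.ae_exists_dominates (hQ : M.Atomless Q) {N : ℕ} (hN : n ≤ N) :
    ∀ᵐ z ∂(Measure.pi fun _ : Fin N => Q),
      ∃ I ∈ Finset.powersetCard n (Finset.univ : Finset (Fin N)), M.Dominates I z := by
  filter_upwards [hQ.ae_generic N] with z hz
  obtain ⟨I, hcard, hact, hopt⟩ := M.exists_active_basis z
  have hz' := hz I
  rw [hopt] at hz'
  have hle (j : Fin N) : M.f (z j) (M.opt (Set.range z)) ≤ 0 := (M.opt_mem _).2 _ ⟨j, rfl⟩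
  obtain ⟨T, hIT, hTcard, hT⟩ := exists_top_subset
    (φ := fun j => M.f (z j) (M.opt (Set.range z))) (I := I)
    (fun i hi j hj => by
      simp only [hact i hi]
      exact lt_of_le_of_ne (hle j) (hz' j hj).1)
    (fun j hj j' hj' => (hz' j hj).2 j' hj') hcard (by simpa using hN)
  refine ⟨T, by simp [Finset.mem_powersetCard, hTcard], ?_⟩
  have hTopt : M.opt (z '' T) = M.opt (Set.range z) := by
    rw [← hopt]
    refine (M.opt_eq_of_subset (Set.image_mono (Finset.coe_subset.2 hIT)) ?_).symm
    rw [hopt]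
    exact M.feas_anti (Set.image_subset_range _ _) (M.opt_mem _)
  intro i hi j hj
  rw [hTopt]
  exact hT i hi j hj

variable (M Q)

/-- The probability that a new constraint has at most the slack of some sampled one at the
optimizer. -/
noncomputable def riskBound {m : ℕ} (w : Fin m → Z) : ℝ :=
  Q.real {x | ∃ i, M.f (w i) (M.opt (Set.range w)) ≤ M.f x (M.opt (Set.range w))}

lemma measurableSet_slack_le (m : ℕ) : MeasurableSet {p : (Fin m → Z) × Z |
    ∃ i, M.f (p.1 i) (M.opt (Set.range p.1)) ≤ M.f p.2 (M.opt (Set.range p.1))} := by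
  have hopt : Measurable fun p : (Fin m → Z) × Z => M.opt (Set.range p.1) :=
    M.measurable_opt_range.comp measurable_fst
  simp only [Set.ofPred_exists]
  exact MeasurableSet.iUnion fun i => measurableSet_le
    (M.measurable_f_comp ((measurable_pi_apply i).comp measurable_fst) hopt)
    (M.measurable_f_comp measurable_snd hopt)

lemma measurable_riskBound (m : ℕ) : Measurable (M.riskBound Q (m := m)) :=
  (measurable_measure_prodMk_left (ν := Q) (M.measurableSet_slack_le m)).ennreal_toReal

lemma riskBound_mem (m : ℕ) (w : Fin m → Z) : M.riskBound Q w ∈ Set.Icc (0 : ℝ) 1 :=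
  ⟨measureReal_nonneg, measureReal_le_one⟩

/-- The probability that a new constraint has at most the slack of some constraint in `I` at the
optimizer for `I`. -/
noncomputable def riskOn {ι : Type*} (I : Finset ι) (z : ι → Z) : ℝ :=
  Q.real {x | ∃ i ∈ I, M.f (z i) (M.opt (z '' I)) ≤ M.f x (M.opt (z '' I))}

/-- Fubini, conditioning on the samples in `I`: the optimizer and the risk are then fixed, and each
of the `m` remaining samples must independently avoid a set of measure `riskBound`. -/
lemma measureReal_dominates {N k m : ℕ} (I : Finset (Fin N)) (hk : I.card = k)
    (hm : Iᶜ.card = m) {A : Set ℝ} (hA : MeasurableSet A) :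
    MeasurableSet {z | M.Dominates I z ∧ M.riskOn Q I z ∈ A} ∧
    (Measure.pi fun _ : Fin N => Q).real {z | M.Dominates I z ∧ M.riskOn Q I z ∈ A} =
      ∫ w in {w | M.riskBound Q w ∈ A}, (1 - M.riskBound Q w) ^ m
        ∂(Measure.pi fun _ : Fin k => Q) := by
  set e := finSumEquivOfFinset hk hm with he
  have hmemI (l : Fin k) : e (.inl l) ∈ I := by
    rw [he, finSumEquivOfFinset_inl]; exact Finset.orderEmbOfFin_mem _ _ _
  have hmemC (l : Fin m) : e (.inr l) ∉ I := by
    rw [← Finset.mem_compl, he, finSumEquivOfFinset_inr]; exact Finset.orderEmbOfFin_mem _ _ _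
  have hsurjI (i : Fin N) (hi : i ∈ I) : ∃ l, e (.inl l) = i := by
    obtain ⟨l | l, rfl⟩ := e.surjective i
    · exact ⟨l, rfl⟩
    · exact absurd hi (hmemC l)
  have hsurjC (i : Fin N) (hi : i ∉ I) : ∃ l, e (.inr l) = i := by
    obtain ⟨l | l, rfl⟩ := e.surjective i
    · exact absurd (hmemI l) hi
    · exact ⟨l, rfl⟩
  have hI (z : Fin N → Z) : z '' I = Set.range fun i => z (e (.inl i)) := by
    ext x
    constructor
    · rintro ⟨i, hi, rfl⟩
      obtain ⟨l, rfl⟩ := hsurjI i hi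
      exact ⟨l, rfl⟩
    · rintro ⟨l, rfl⟩
      exact ⟨_, hmemI l, rfl⟩
  have hrisk (z : Fin N → Z) : M.riskOn Q I z = M.riskBound Q fun i => z (e (.inl i)) := by
    rw [riskOn, riskBound, hI]
    congr 1
    ext x
    constructor
    · rintro ⟨i, hi, h⟩
      obtain ⟨l, rfl⟩ := hsurjI i hi
      exact ⟨l, h⟩
    · rintro ⟨l, h⟩
      exact ⟨_, hmemI l, h⟩
  let V : (Fin k → Z) → Set Z := fun w =>
    {x | ∃ i, M.f (w i) (M.opt (Set.range w)) ≤ M.f x (M.opt (Set.range w))}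
  have hV (w : Fin k → Z) : MeasurableSet (V w) :=
    measurable_prodMk_left (M.measurableSet_slack_le k)
  let T : Set ((Fin k → Z) × (Fin m → Z)) :=
    {p | M.riskBound Q p.1 ∈ A ∧ ∀ j, p.2 j ∉ V p.1}
  have hset : {z | M.Dominates I z ∧ M.riskOn Q I z ∈ A} =
      (fun z : Fin N → Z => (fun i => z (e (.inl i)), fun j => z (e (.inr j)))) ⁻¹' T := by
    ext z
    simp only [T, V, Set.mem_preimage, Set.mem_ofPred_eq, Dominates, hI, hrisk, not_exists, not_le]
    rw [and_comm]
    refine and_congr_right fun _ => ?_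
    constructor
    · exact fun h j i => h _ (hmemI i) _ (hmemC j)
    · intro h i hi j hj
      obtain ⟨l, rfl⟩ := hsurjI i hi
      obtain ⟨l', rfl⟩ := hsurjC j hj
      exact h l' l
  have hWm := M.measurable_riskBound Q k
  have hAm : MeasurableSet {w | M.riskBound Q (m := k) w ∈ A} := hWm hA
  have hT : MeasurableSet T := by
    have h1 : MeasurableSet {p : (Fin k → Z) × (Fin m → Z) | M.riskBound Q p.1 ∈ A} :=
      measurable_fst hAm
    have h2 (j : Fin m) : MeasurableSet {p : (Fin k → Z) × (Fin m → Z) | p.2 j ∈ V p.1} := by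
      have hpair : Measurable fun p : (Fin k → Z) × (Fin m → Z) => (p.1, p.2 j) := by fun_prop
      exact hpair (M.measurableSet_slack_le k)
    have : T = {p | M.riskBound Q p.1 ∈ A} ∩ ⋂ j, {p | p.2 j ∈ V p.1}ᶜ := by
      ext; simp [T]
    rw [this]
    exact h1.inter (MeasurableSet.iInter fun j => (h2 j).compl)
  have hsec (w : Fin k → Z) : (Measure.pi fun _ : Fin m => Q) (Prod.mk w ⁻¹' T) =
      {w | M.riskBound Q w ∈ A}.indicator
        (fun w => ENNReal.ofReal ((1 - M.riskBound Q w) ^ m)) w := by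
    by_cases hw : M.riskBound Q w ∈ A
    · rw [Set.indicator_of_mem (by exact hw)]
      have : Prod.mk w ⁻¹' T = Set.univ.pi fun _ => (V w)ᶜ := by
        ext v; simp [T, hw]
      rw [this, Measure.pi_pi, Finset.prod_const, Finset.card_univ, Fintype.card_fin,
        ENNReal.ofReal_pow (by linarith [(M.riskBound_mem Q k w).2])]
      congr 1
      rw [← ofReal_measureReal, probReal_compl_eq_one_sub (hV w)]
      rfl
    · rw [Set.indicator_of_notMem (by exact hw)]
      have : Prod.mk w ⁻¹' T = ∅ := by ext v; simp [T, hw]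
      rw [this, measure_empty]
  have hmp := measurePreserving_split Q e
  refine ⟨hset ▸ hmp.measurable hT, ?_⟩
  rw [hset, measureReal_def, hmp.measure_preimage hT.nullMeasurableSet, Measure.prod_apply hT]
  simp_rw [hsec]
  rw [lintegral_indicator hAm, integral_eq_lintegral_of_nonneg_ae]
  · exact .of_forall fun w => pow_nonneg (by linarith [(M.riskBound_mem Q k w).2]) _
  · fun_prop

lemma measureReal_biUnion_dominates (hn : 0 < n) (m : ℕ) {A : Set ℝ} (hA : MeasurableSet A) :
    (Measure.pi fun _ : Fin (n + m) => Q).real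
      (⋃ I ∈ Finset.powersetCard n (Finset.univ : Finset (Fin (n + m))),
        {z | M.Dominates I z ∧ M.riskOn Q I z ∈ A}) =
      ((n + m).choose n : ℝ) * ∫ w in {w | M.riskBound Q w ∈ A}, (1 - M.riskBound Q w) ^ m
        ∂(Measure.pi fun _ : Fin n => Q) := by
  have hcard {I : Finset (Fin (n + m))} (hI : I ∈ Finset.powersetCard n Finset.univ) :
      I.card = n ∧ Iᶜ.card = m := by
    have := (Finset.mem_powersetCard.1 hI).2
    refine ⟨this, ?_⟩
    rw [Finset.card_compl, this, Fintype.card_fin]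
    omega
  rw [measureReal_biUnion_finset]
  · rw [Finset.sum_congr rfl fun I hI =>
      (M.measureReal_dominates Q I (hcard hI).1 (hcard hI).2 hA).2, Finset.sum_const,
      Finset.card_powersetCard, Finset.card_univ, Fintype.card_fin, nsmul_eq_mul]
  · intro I hI J hJ hne
    refine Set.disjoint_left.2 fun z hz hz' => hne ?_
    have h1 := (hcard hI).1
    exact hz.1.unique hz'.1 (Finset.card_pos.1 (by omega)) (h1.trans (hcard hJ).1.symm)
  · exact fun I hI => (M.measureReal_dominates Q I (hcard hI).1 (hcard hI).2 hA).1

variable {M Q}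

lemma Atomless.risk_tail_le (hQ : M.Atomless Q) (hn : 0 < n) (N : ℕ) {ε : ℝ} (h0 : 0 ≤ ε)
    (h1 : ε ≤ 1) :
    (Measure.pi fun _ : Fin N => Q).real {z | ε < Q.real {x | 0 < M.f x (M.opt (Set.range z))}} ≤
      binomTail n N ε := by
  rcases Nat.lt_or_ge N n with hN | hN
  · rw [binomTail_of_lt hN]
    exact measureReal_le_one
  obtain ⟨m, rfl⟩ := Nat.exists_eq_add_of_le hN
  -- Dominating n-subsets are disjoint events that almost surely cover everything, for every number
  -- `m` of further samples, not only the given one.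
  have hmoment (m : ℕ) : ((n + m).choose n : ℝ) *
      ∫ w, (1 - M.riskBound Q w) ^ m ∂(Measure.pi fun _ : Fin n => Q) = 1 := by
    have h := M.measureReal_biUnion_dominates Q hn m MeasurableSet.univ
    simp only [Set.mem_univ, and_true, Set.ofPred_true, Measure.restrict_univ] at h
    rw [← h]
    refine (measureReal_congr (Filter.eventuallyEq_univ.2 ?_)).trans probReal_univ
    filter_upwards [hQ.ae_exists_dominates (Nat.le_add_right n m)] with z hz
    obtain ⟨I, hI, hdom⟩ := hz
    exact Set.mem_iUnion₂.2 ⟨I, hI, hdom⟩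
  have hmain : ((n + m).choose n : ℝ) * ∫ w in {w | ε < M.riskBound Q w},
      (1 - M.riskBound Q w) ^ m ∂(Measure.pi fun _ : Fin n => Q) = binomTail n (n + m) ε := by
    obtain ⟨k, rfl⟩ : ∃ k, n = k + 1 := ⟨n - 1, by omega⟩
    exact setIntegral_eq_binomTail_of_moments (M.measurable_riskBound Q _)
      (M.riskBound_mem Q _) hmoment h0 h1 m
  have hunion := M.measureReal_biUnion_dominates Q hn m (measurableSet_Ioi (a := ε))
  simp only [Set.mem_Ioi] at hunion
  rw [← hmain, ← hunion]
  refine ENNReal.toReal_mono (measure_ne_top _ _) (measure_mono_ae ?_)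
  filter_upwards [hQ.ae_exists_dominates (Nat.le_add_right n m)] with z hz hε
  obtain ⟨I, hI, hdom⟩ := hz
  refine Set.mem_iUnion₂.2 ⟨I, hI, hdom, lt_of_lt_of_le hε ?_⟩
  have hne : I.Nonempty := by
    rw [← Finset.card_pos, (Finset.mem_powersetCard.1 hI).2]; exact hn
  refine measureReal_mono fun x hx => ?_
  rw [← hdom.opt_eq hne] at hx
  obtain ⟨i, hi⟩ := hne
  exact ⟨i, hi, ((M.opt_mem (z '' I)).2 (z i) ⟨i, hi, rfl⟩).trans (le_of_lt hx)⟩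

end SampledProgram

/-! ### Dual norms -/

section DualNorm

variable {X C : Type*} [NormedAddCommGroup X] [NormedSpace ℝ X] [AddCommGroup C] [Module ℝ C]
  {p : X →ₗ[ℝ] C →ₗ[ℝ] ℝ}

lemma IsDualPair.le_dualNorm (hp : IsDualPair p) {x : X} (hx : ‖x‖ ≤ 1) (c : C) :
    p x c ≤ dualNorm p c :=
  le_csSup (hp.bddAbove c) ⟨x, hx, rfl⟩

lemma IsDualPair.dualNorm_nonneg (hp : IsDualPair p) (c : C) : 0 ≤ dualNorm p c := by
  simpa using hp.le_dualNorm (x := 0) (by simp) c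

lemma IsDualPair.apply_le (hp : IsDualPair p) (x : X) (c : C) : p x c ≤ ‖x‖ * dualNorm p c := by
  rcases eq_or_ne x 0 with rfl | hx
  · simp
  have hpos : 0 < ‖x‖ := norm_pos_iff.2 hx
  have h := hp.le_dualNorm (x := ‖x‖⁻¹ • x) (by simp [norm_smul, hpos.ne']) c
  rw [map_smul, LinearMap.smul_apply, smul_eq_mul, inv_mul_le_iff₀ hpos] at h
  exact h

lemma dualNorm_smul {r : ℝ} (hr : 0 ≤ r) (c : C) :
    dualNorm p (r • c) = r * dualNorm p c := by
  rw [dualNorm, dualNorm, ← smul_eq_mul, ← Real.sSup_smul_of_nonneg hr]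
  congr 1
  ext s
  simp only [Set.mem_smul_set, Set.mem_ofPred_eq, map_smul, smul_eq_mul]
  constructor
  · rintro ⟨x, hx, rfl⟩
    exact ⟨p x c, ⟨x, hx, rfl⟩, rfl⟩
  · rintro ⟨_, ⟨x, hx, rfl⟩, rfl⟩
    exact ⟨x, hx, rfl⟩

end DualNorm

/-! ### A finite minimax principle -/

/-- Hahn–Banach separates `S` from the orthant of vectors with all coordinates at most `v`; the
normalised coefficients of the separating functional are the weights. -/
lemma exists_convex_weights {ι : Type*} [Fintype ι] {S : Set (ι → ℝ)} (hS : IsCompact S)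
    (hconv : Convex ℝ S) (hne : S.Nonempty) {v : ℝ} (h : ∀ x ∈ S, ∃ i, v < x i) :
    ∃ w : ι → ℝ, (∀ i, 0 ≤ w i) ∧ ∑ i, w i = 1 ∧ ∀ x ∈ S, v ≤ ∑ i, w i * x i := by
  classical
  let T : Set (ι → ℝ) := {x | ∀ i, x i ≤ v}
  have hT : IsClosed T := by
    have : T = ⋂ i, {x | x i ≤ v} := by ext; simp [T]
    rw [this]
    exact isClosed_iInter fun i => isClosed_le (continuous_apply i) continuous_const
  have hTc : Convex ℝ T := by
    intro x hx y hy a b ha hb hab i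
    have h1 := mul_le_mul_of_nonneg_left (hx i) ha
    have h2 := mul_le_mul_of_nonneg_left (hy i) hb
    simp only [Pi.add_apply, Pi.smul_apply, smul_eq_mul]
    calc a * x i + b * y i ≤ (a + b) * v := by linarith
      _ = v := by rw [hab, one_mul]
  have hdisj : Disjoint S T := Set.disjoint_left.2 fun x hx hxT => by
    obtain ⟨i, hi⟩ := h x hx
    exact absurd (hxT i) (not_le.2 hi)
  obtain ⟨f, u, u', hfS, huu, hfT⟩ := geometric_hahn_banach_compact_closed hconv hS hTc hT hdisj
  let l : ι → ℝ := fun i => -f (Pi.single i 1)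
  have hf (x : ι → ℝ) : f x = -∑ i, l i * x i := by
    conv_lhs => rw [← Finset.univ_sum_single x]
    rw [map_sum, ← Finset.sum_neg_distrib]
    refine Finset.sum_congr rfl fun i _ => ?_
    have : (Pi.single i (x i) : ι → ℝ) = x i • Pi.single i 1 := by
      rw [← Pi.single_smul, smul_eq_mul, mul_one]
    rw [this, map_smul, smul_eq_mul]
    simp only [l]
    ring
  have hl (i : ι) : 0 ≤ l i := by
    by_contra! hneg
    have hconst := hfT (fun _ => v) fun _ => le_rfl
    -- Were `l i` negative, descending by this amount in coordinate `i` would stay in the orthant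
    -- while lowering `f` exactly to `u'`.
    let r : ℝ := (f (fun _ => v) - u') / (-l i)
    have hr : 0 ≤ r := div_nonneg (by linarith) (by linarith)
    have hmem : (fun _ => v) - r • (Pi.single i 1 : ι → ℝ) ∈ T := by
      intro j
      have : 0 ≤ (Pi.single i 1 : ι → ℝ) j := by
        rcases eq_or_ne j i with rfl | hj
        · simp
        · simp [hj]
      have := mul_nonneg hr this
      simp only [Pi.sub_apply, Pi.smul_apply, smul_eq_mul]
      linarith
    have h1 := hfT _ hmem
    rw [map_sub, map_smul, smul_eq_mul] at h1
    have h2 : r * f (Pi.single i 1) = f (fun _ => v) - u' := by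
      have : f (Pi.single i 1) = -l i := by simp [l]
      rw [this]
      exact div_mul_cancel₀ _ (by linarith)
    linarith
  have hgap (x : ι → ℝ) (hx : x ∈ S) : (∑ i, l i) * v < ∑ i, l i * x i := by
    have h1 := hfS x hx
    have h2 := hfT (fun _ => v) fun _ => le_rfl
    rw [hf] at h1 h2
    rw [Finset.sum_mul]
    linarith
  have hpos : 0 < ∑ i, l i := by
    refine lt_of_le_of_ne (Finset.sum_nonneg fun i _ => hl i) fun h0 => ?_
    obtain ⟨x, hx⟩ := hne
    have h1 := hgap x hx
    have h2 : ∀ i, l i = 0 := fun i =>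
      (Finset.sum_eq_zero_iff_of_nonneg fun i _ => hl i).1 h0.symm i (Finset.mem_univ i)
    simp [h2] at h1
  refine ⟨fun i => l i / ∑ i, l i, fun i => div_nonneg (hl i) hpos.le, ?_, fun x hx => ?_⟩
  · rw [← Finset.sum_div, div_self hpos.ne']
  · have := hgap x hx
    simp_rw [div_mul_eq_mul_div]
    rw [← Finset.sum_div, le_div_iff₀ hpos]
    linarith

namespace Program

variable {X C B Y : Type*} [NormedAddCommGroup X] [NormedSpace ℝ X]
  [AddCommGroup C] [Module ℝ C] [NormedAddCommGroup B] [NormedSpace ℝ B]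
  [AddCommGroup Y] [Module ℝ Y] {n : ℕ} (L : Program X C B Y n)

/-! ### The norm on `ℝⁿ` -/

lemma continuous_R : Continuous L.R := by
  have hle (α : Fin n → ℝ) : L.R α ≤ (∑ i, L.R (Pi.single i 1)) * ‖α‖ := by
    conv_lhs => rw [← Finset.univ_sum_single α]
    refine (Finset.le_sum_of_subadditive L.R (map_zero _).le (map_add_le_add L.R) _ _).trans ?_
    rw [Finset.sum_mul]
    refine Finset.sum_le_sum fun i _ => ?_
    have : (Pi.single i (α i) : Fin n → ℝ) = α i • Pi.single i 1 := by
      rw [← Pi.single_smul, smul_eq_mul, mul_one]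
    rw [this, map_smul_eq_mul, mul_comm]
    exact mul_le_mul_of_nonneg_left (norm_le_pi_norm α i) (apply_nonneg _ _)
  refine continuous_iff_continuousAt.2 fun α => ?_
  rw [ContinuousAt, tendsto_iff_dist_tendsto_zero]
  refine squeeze_zero (fun _ => dist_nonneg)
    (fun β => (abs_sub_map_le_sub L.R β α).trans (hle (β - α))) ?_
  have : Continuous fun β : Fin n → ℝ => (∑ i, L.R (Pi.single i 1)) * ‖β - α‖ := by fun_prop
  simpa using this.tendsto α

lemma exists_norm_le : ∃ k : ℝ, 0 < k ∧ ∀ α, ‖α‖ ≤ k * L.R α := by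
  have hscale (α : Fin n → ℝ) (hα : α ≠ 0) : ‖α‖⁻¹ • α ∈ Metric.sphere (0 : Fin n → ℝ) 1 := by
    simp [norm_smul, hα]
  -- The sphere is empty when n = 0.
  rcases (Metric.sphere (0 : Fin n → ℝ) 1).eq_empty_or_nonempty with hemp | hne
  · refine ⟨1, one_pos, fun α => ?_⟩
    rcases eq_or_ne α 0 with rfl | hα
    · simp
    · exact absurd (hscale α hα) (by simp [hemp])
  · obtain ⟨β, hβ, hmin⟩ := (isCompact_sphere (0 : Fin n → ℝ) 1).exists_isMinOn hne
      L.continuous_R.continuousOn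
    have hpos : 0 < L.R β := by
      refine lt_of_le_of_ne (apply_nonneg _ _) fun h => ?_
      have := L.R_definite β h.symm
      simp [this] at hβ
    refine ⟨(L.R β)⁻¹, inv_pos.2 hpos, fun α => ?_⟩
    rcases eq_or_ne α 0 with rfl | hα
    · simp
    · have h := hmin (hscale α hα)
      have hα' : 0 < ‖α‖ := norm_pos_iff.2 hα
      simp only [Set.mem_ofPred_eq, map_smul_eq_mul, norm_inv, norm_norm] at h
      rw [inv_mul_eq_div, le_div_iff₀ hpos, mul_comm]
      rwa [inv_mul_eq_div, le_div_iff₀ hα'] at h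

lemma isCompact_R_le (r : ℝ) : IsCompact {α | L.R α ≤ r} := by
  obtain ⟨k, hk, h⟩ := L.exists_norm_le
  refine (isCompact_closedBall (0 : Fin n → ℝ) (k * r)).of_isClosed_subset
    (isClosed_le L.continuous_R continuous_const) fun α hα => ?_
  rw [mem_closedBall_zero_iff]
  exact (h α).trans (mul_le_mul_of_nonneg_left hα hk.le)

lemma convex_R_le (r : ℝ) : Convex ℝ {α | L.R α ≤ r} := by
  simpa using L.R.convexOn.convex_le r

lemma bddAbove_of_continuous {g : (Fin n → ℝ) → ℝ} (hg : Continuous g) :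
    BddAbove {r : ℝ | ∃ α : Fin n → ℝ, L.R α ≤ 1 ∧ r = g α} := by
  refine ((L.isCompact_R_le 1).image hg).bddAbove.mono ?_
  rintro _ ⟨α, hα, rfl⟩
  exact ⟨α, hα, rfl⟩

lemma dotProduct_le_RDual {θ : ℝ} (hθ : 0 < θ) {α : Fin n → ℝ} (hα : L.R α ≤ θ)
    (v : Fin n → ℝ) : α ⬝ᵥ v ≤ θ * L.RDual v := by
  have h : (θ⁻¹ • α) ⬝ᵥ v ≤ L.RDual v := by
    refine le_csSup (L.bddAbove_of_continuous (g := fun α => α ⬝ᵥ v) (by fun_prop)) ⟨_, ?_, rfl⟩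
    rw [map_smul_eq_mul, norm_inv, Real.norm_of_nonneg hθ.le, inv_mul_le_iff₀ hθ, mul_one]
    exact hα
  rwa [smul_dotProduct, smul_eq_mul, inv_mul_le_iff₀ hθ] at h

lemma mul_RDual_le {θ m : ℝ} (hθ : 0 < θ) {v : Fin n → ℝ}
    (h : ∀ α, L.R α ≤ θ → α ⬝ᵥ v ≤ m) : θ * L.RDual v ≤ m := by
  rw [mul_comm, ← le_div_iff₀ hθ]
  refine csSup_le ⟨0, 0, by simp, by simp⟩ ?_
  rintro _ ⟨α, hα, rfl⟩
  rw [le_div_iff₀ hθ, mul_comm]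
  have := h (θ • α) (by
    rw [map_smul_eq_mul, Real.norm_of_nonneg hθ.le]
    exact mul_le_of_le_one_right hθ.le hα)
  rwa [smul_dotProduct, smul_eq_mul] at this

/-! ### Strong duality -/

lemma pB_An (α : Fin n → ℝ) (y : Y) : L.pB (L.An α) y = α ⬝ᵥ L.AnAdj y := by
  simp [An, AnAdj, dotProduct]

lemma pB_residual (α : Fin n → ℝ) (y : Y) :
    L.pB (-L.An α + L.b) y = L.pB L.b y - α ⬝ᵥ L.AnAdj y := by
  rw [map_add, map_neg, LinearMap.add_apply, LinearMap.neg_apply, pB_An]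
  ring

/-- Weak closedness of the cone makes the separating functional weakly continuous, hence an element
of `Y`. A functional bounded above on a cone is nonpositive there. -/
lemma exists_separating {δ : B} (hδ : δ ∉ L.K) : ∃ y ∈ L.dualCone, L.pB δ y < 0 := by
  have hconv : Convex ℝ (L.K : Set B) := L.K.convex
  obtain ⟨f, u, hK, hu⟩ := geometric_hahn_banach_closed_point (E := WeakBilin L.pB) hconv
    L.K_closed hδ
  obtain ⟨y, rfl⟩ := LinearMap.dualEmbedding_surjective L.pB f
  have hu0 : 0 < u := by
    have := hK 0 (Submodule.zero_mem L.K)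
    rwa [map_zero] at this
  have hK' (k : B) (hk : k ∈ L.K) : L.pB k y < u := hK k hk
  have hu' : u < L.pB δ y := hu
  refine ⟨-y, fun k hk => ?_, by rw [map_neg]; linarith⟩
  rw [map_neg, Left.nonneg_neg_iff]
  by_contra! hpos
  have h1 := hK' ((u / L.pB k y) • k)
    (L.K.smul_mem (div_pos hu0 hpos).le hk)
  rw [map_smul, LinearMap.smul_apply, smul_eq_mul, div_mul_cancel₀ _ hpos.ne'] at h1
  exact lt_irrefl _ h1

lemma bddBelow_cost {S : Set (Fin n → ℝ)} (hS : ∀ α ∈ S, L.R α ≤ L.θP) :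
    BddBelow ((fun α => α ⬝ᵥ L.cvec) '' S) :=
  ((L.isCompact_R_le L.θP).image (f := fun α => α ⬝ᵥ L.cvec) (by fun_prop)).bddBelow.mono
    (Set.image_mono hS)

lemma Jn_le {α : Fin n → ℝ} (hα : α ∈ L.feasible) : L.Jn ≤ α ⬝ᵥ L.cvec :=
  csInf_le (L.bddBelow_cost fun _ h => h.2) ⟨α, hα, rfl⟩

/-- An almost optimal multiplier, without a Slater condition. Each α in the ball has some y with
Lagrangian above `v`: zero if α is feasible, otherwise a large multiple of a separating functional.
Compactness leaves finitely many y, which convex weights merge into one. -/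
lemma exists_dual_point (hne : L.feasible.Nonempty) {v : ℝ} (hv : v < L.Jn) :
    ∃ y ∈ L.dualCone, ∀ α, L.R α ≤ L.θP →
      v ≤ α ⬝ᵥ L.cvec + (L.pB L.b y - α ⬝ᵥ L.AnAdj y) := by
  classical
  let g : (Fin n → ℝ) → Y → ℝ := fun α y => α ⬝ᵥ L.cvec + (L.pB L.b y - α ⬝ᵥ L.AnAdj y)
  have hg (y : Y) : Continuous fun α => g α y := by simp only [g]; fun_prop
  have hpoint (α : Fin n → ℝ) (hα : L.R α ≤ L.θP) : ∃ y ∈ L.dualCone, v < g α y := by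
    by_cases hK : L.An α - L.b ∈ L.K
    · refine ⟨0, Submodule.zero_mem _, ?_⟩
      have h0 : L.AnAdj 0 = 0 := by ext; simp [AnAdj]
      simp only [g, h0, map_zero, dotProduct_zero, sub_zero, add_zero]
      exact hv.trans_le (L.Jn_le ⟨hK, hα⟩)
    · obtain ⟨y, hy, hneg⟩ := L.exists_separating hK
      rw [map_sub, LinearMap.sub_apply, pB_An] at hneg
      obtain ⟨r, hr⟩ := exists_nat_gt ((v - α ⬝ᵥ L.cvec) / (L.pB L.b y - α ⬝ᵥ L.AnAdj y))
      rw [div_lt_iff₀ (by linarith)] at hr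
      refine ⟨(r : ℝ) • y, L.dualCone.smul_mem r.cast_nonneg hy, ?_⟩
      have hadj : L.AnAdj ((r : ℝ) • y) = (r : ℝ) • L.AnAdj y := by ext; simp [AnAdj]
      simp only [g, hadj, map_smul, dotProduct_smul, smul_eq_mul]
      linarith
  obtain ⟨t, ht⟩ := (L.isCompact_R_le L.θP).elim_finite_subcover
    (fun y : L.dualCone => {α | v < g α y}) (fun y => isOpen_lt continuous_const (hg y))
    (fun α hα => by
      obtain ⟨y, hy, h⟩ := hpoint α hα
      exact Set.mem_iUnion.2 ⟨⟨y, hy⟩, h⟩)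
  let G : (Fin n → ℝ) → (t → ℝ) := fun α y => g α y
  have hGcont : Continuous G := continuous_pi fun y => hg y
  have hGconv : Convex ℝ (G '' {α | L.R α ≤ L.θP}) := by
    rintro _ ⟨α, hα, rfl⟩ _ ⟨β, hβ, rfl⟩ p q hp hq hpq
    refine ⟨p • α + q • β, L.convex_R_le _ hα hβ hp hq hpq, funext fun y => ?_⟩
    have : q = 1 - p := by linarith
    simp only [G, g, add_dotProduct, smul_dotProduct, smul_eq_mul, Pi.add_apply, Pi.smul_apply,
      this]
    ring
  obtain ⟨α₀, hα₀⟩ := hne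
  obtain ⟨w, hw0, hw1, hw⟩ := exists_convex_weights ((L.isCompact_R_le L.θP).image hGcont) hGconv
    ⟨_, α₀, hα₀.2, rfl⟩ (v := v) (by
      rintro _ ⟨α, hα, rfl⟩
      obtain ⟨y, hy, h⟩ := Set.mem_iUnion₂.1 (ht hα)
      exact ⟨⟨y, hy⟩, h⟩)
  refine ⟨∑ y, w y • (y : Y), Submodule.sum_mem _ fun y _ =>
    L.dualCone.smul_mem (hw0 y) (y : L.dualCone).2, fun α hα => ?_⟩
  refine (hw _ ⟨α, hα, rfl⟩).trans_eq ?_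
  have hadj : L.AnAdj (∑ y, w y • (y : Y)) = ∑ y, w y • L.AnAdj (y : Y) := by
    ext; simp [AnAdj]
  rw [hadj, dotProduct_sum, map_sum]
  simp only [G, g, mul_add, mul_sub, Finset.sum_add_distrib, Finset.sum_sub_distrib,
    ← Finset.sum_mul, hw1, one_mul, map_smul, dotProduct_smul, smul_eq_mul]

variable {L}

lemma Regular.θP_pos {γ : ℝ} (h : L.Regular γ) : 0 < L.θP :=
  pos_of_mul_pos_right ((norm_nonneg _).trans_lt h.θP_large) h.γ_pos.le

lemma Regular.thetaD_nonneg {γ : ℝ} (h : L.Regular γ) {JLB : ℝ} (hJ : JLB ≤ L.Jn) :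
    0 ≤ L.thetaD γ JLB := by
  refine div_nonneg ?_ (sub_nonneg.2 h.θP_large.le)
  obtain ⟨α, hα⟩ := h.feasible_nonempty
  have h1 := L.Jn_le hα
  have h2 := L.dotProduct_le_RDual h.θP_pos hα.2 L.cvec
  linarith

/-- A point whose constraint violation is at most `ζ` is at most `θ_D ζ` better than the optimum. -/
lemma Regular.Jn_sub_le {γ : ℝ} (h : L.Regular γ) {JLB : ℝ} (hJ : JLB ≤ L.Jn) {α : Fin n → ℝ}
    (hα : L.R α ≤ L.θP) {ζ : ℝ} (hζ : 0 ≤ ζ)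
    (hviol : ∀ y ∈ L.dualCone, L.pB (-L.An α + L.b) y ≤ ζ * L.normY y) :
    L.Jn - α ⬝ᵥ L.cvec ≤ L.thetaD γ JLB * ζ := by
  have hden : 0 < γ * L.θP - ‖L.b‖ := sub_pos.2 h.θP_large
  set d := γ * L.θP - ‖L.b‖ with hd
  have hk : 0 < 1 + ζ / d := by positivity
  refine le_of_forall_pos_le_add fun e he => ?_
  have hη : 0 < e / (1 + ζ / d) := div_pos he hk
  -- The duality gap η costs η directly and, through the bound θ_D + η/d on ‖y‖, a further ζη/d; the
  -- total is `e`.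
  set η := e / (1 + ζ / d) with hηd
  obtain ⟨y, hy, hdual⟩ := L.exists_dual_point h.feasible_nonempty (v := L.Jn - η) (by linarith)
  have hb : L.pB L.b y ≤ ‖L.b‖ * L.normY y := L.isDualPair_B.apply_le _ _
  have h1 : L.θP * L.RDual (L.AnAdj y) ≤
      L.θP * L.RDual L.cvec + ‖L.b‖ * L.normY y - (L.Jn - η) := by
    refine L.mul_RDual_le h.θP_pos fun α' hα' => ?_
    have := hdual α' hα'
    have := L.dotProduct_le_RDual h.θP_pos hα' L.cvec
    linarith
  have h2 : γ * L.normY y * L.θP ≤ L.θP * L.RDual (L.AnAdj y) := by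
    rw [mul_comm L.θP]
    exact mul_le_mul_of_nonneg_right (h.inf_sup y hy) h.θP_pos.le
  have h3 : L.normY y ≤ L.thetaD γ JLB + η / d := by
    rw [thetaD, ← hd, ← add_div, le_div_iff₀ hden, hd]
    linarith
  have h4 := hdual α hα
  have h5 := hviol y hy
  rw [pB_residual] at h5
  have h6 := mul_le_mul_of_nonneg_left h3 hζ
  have h7 : η * (1 + ζ / d) = e := div_mul_cancel₀ _ hk.ne'
  have h8 : ζ * (L.thetaD γ JLB + η / d) = L.thetaD γ JLB * ζ + (η * (1 + ζ / d) - η) := by ring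
  linarith

/-! ### Reduction to the extreme points -/

/-- Krein–Milman for the truncated dual cone: each of its extreme points has norm zero, where the
bound is trivial, or belongs to `extremal`. -/
lemma le_mul_normY_of_le_extremal
    (hcompact : IsWeaklyCompact L.pB.flip {y : Y | y ∈ L.dualCone ∧ L.normY y ≤ 1})
    {δ : B} {ζ : ℝ} (hζ : 0 ≤ ζ) (h : ∀ y ∈ L.extremal, L.pB δ y ≤ ζ) {y : Y}
    (hy : y ∈ L.dualCone) : L.pB δ y ≤ ζ * L.normY y := by
  have hnn (y : Y) : 0 ≤ L.normY y := L.isDualPair_B.dualNorm_nonneg y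
  have hsmul {r : ℝ} (hr : 0 ≤ r) (y : Y) : L.normY (r • y) = r * L.normY y := dualNorm_smul hr y
  have hcone {r : ℝ} (hr : 0 ≤ r) {y : Y} (hy : y ∈ L.dualCone) : r • y ∈ L.dualCone :=
    L.dualCone.smul_mem hr hy
  have hconvY : Convex ℝ {y : Y | y ∈ L.dualCone ∧ L.normY y ≤ 1} := by
    rintro x ⟨hx, hx1⟩ z ⟨hz, hz1⟩ a b ha hb hab
    refine ⟨L.dualCone.add_mem (hcone ha hx) (hcone hb hz), csSup_le ⟨0, 0, by simp, by simp⟩ ?_⟩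
    rintro _ ⟨v, hv, rfl⟩
    have h1 : L.pB v x ≤ 1 := (L.isDualPair_B.le_dualNorm hv x).trans hx1
    have h2 : L.pB v z ≤ 1 := (L.isDualPair_B.le_dualNorm hv z).trans hz1
    rw [map_add, map_smul, map_smul, smul_eq_mul, smul_eq_mul]
    nlinarith
  let S : Set (WeakBilin L.pB.flip) := {y : Y | y ∈ L.dualCone ∧ L.normY y ≤ 1}
  have hconv : Convex ℝ S := hconvY
  have hcompactS : IsCompact S := hcompact
  have hT2 : T2Space (WeakBilin L.pB.flip) := by
    refine (WeakBilin.isEmbedding (B := L.pB.flip) fun x z hxz => ?_).t2Space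
    refine sub_eq_zero.1 (L.isDualPair_B.separatingRight _ fun v => ?_)
    have := LinearMap.congr_fun hxz v
    simpa [sub_eq_zero] using this
  have hext : S.extremePoints ℝ ⊆ {y | L.pB δ y ≤ ζ} := by
    intro x hx
    obtain ⟨⟨hxK, hx1⟩, hxe⟩ := mem_extremePoints.1 hx
    rcases (hnn x).eq_or_lt with h0 | h0
    · have := L.isDualPair_B.apply_le δ x
      change L.pB δ x ≤ ‖δ‖ * L.normY x at this
      rw [← h0, mul_zero] at this
      exact this.trans hζ
    · rcases hx1.eq_or_lt with h1 | h1
      · refine h x (mem_extremePoints.2 ⟨⟨hxK, h1⟩, fun u hu v hv huv => ?_⟩)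
        exact hxe u ⟨hu.1, hu.2.le⟩ v ⟨hv.1, hv.2.le⟩ huv
      -- A point with norm strictly between 0 and 1 lies inside the segment from 0 to its
      -- normalisation, so it is not extreme.
      · exfalso
        have hmem1 : (0 : WeakBilin L.pB.flip) ∈ S :=
          ⟨Submodule.zero_mem _, by
            have := hsmul le_rfl (0 : Y)
            rw [zero_smul, zero_mul] at this
            exact this.le.trans zero_le_one⟩
        have hmem2 : (L.normY x)⁻¹ • x ∈ S :=
          ⟨hcone (inv_nonneg.2 h0.le) hxK, by
            have := hsmul (inv_nonneg.2 h0.le) x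
            rw [inv_mul_cancel₀ h0.ne'] at this
            exact this.le⟩
        have hseg : x ∈ openSegment ℝ (0 : WeakBilin L.pB.flip) ((L.normY x)⁻¹ • x) :=
          ⟨1 - L.normY x, L.normY x, by linarith, h0, by ring, by
            rw [smul_zero, zero_add, smul_inv_smul₀ h0.ne']⟩
        have hx0 : (0 : WeakBilin L.pB.flip) = x := (hxe _ hmem1 _ hmem2 hseg).1
        have := hsmul le_rfl (0 : Y)
        rw [zero_smul, zero_mul] at this
        have h00 : L.normY x = L.normY (0 : Y) := congrArg L.normY hx0.symm
        rw [this] at h00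
        exact h0.ne' h00
  have hhalf : S ⊆ {y | L.pB δ y ≤ ζ} := by
    rw [← closure_convexHull_extremePoints hcompactS hconv]
    refine closure_minimal (convexHull_min hext ?_) ?_
    · exact convex_halfSpace_le (𝕜 := ℝ) (L.pB δ).isLinear ζ
    · exact isClosed_le (WeakBilin.eval_continuous L.pB.flip δ) continuous_const
  rcases (hnn y).eq_or_lt with h0 | h0
  · have := L.isDualPair_B.apply_le δ y
    change L.pB δ y ≤ ‖δ‖ * L.normY y at this
    rwa [← h0, mul_zero] at this ⊢
  · have hmem : (L.normY y)⁻¹ • y ∈ S :=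
      ⟨hcone (inv_nonneg.2 h0.le) hy, by
        rw [hsmul (inv_nonneg.2 h0.le), inv_mul_cancel₀ h0.ne']⟩
    have h1 : L.pB δ ((L.normY y)⁻¹ • y) ≤ ζ := hhalf hmem
    rw [map_smul, smul_eq_mul, inv_mul_le_iff₀ h0] at h1
    linarith

end Program

/-! ### Limits of events, measurable hulls and the sample size -/

lemma measure_le_of_eventually_mem {Ω : Type*} [MeasurableSpace Ω] {μ : Measure Ω} {E : Set Ω}
    {S : ℕ → Set Ω} {b : ENNReal} (h : ∀ᵐ x ∂μ, x ∈ E → ∀ᶠ k in Filter.atTop, x ∈ S k)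
    (hS : ∀ k, μ (S k) ≤ b) : μ E ≤ b := by
  -- A Fatou argument for sets; continuity along increasing unions holds for the outer measure, so
  -- no measurability is needed.
  have h1 : μ E ≤ μ (⋃ i, ⋂ k ≥ i, S k) := by
    refine measure_mono_ae ?_
    filter_upwards [h] with x hx hE
    obtain ⟨i, hi⟩ := Filter.eventually_atTop.1 (hx hE)
    exact Set.mem_iUnion.2 ⟨i, Set.mem_iInter₂.2 hi⟩
  have hmono : Monotone fun i => ⋂ k ≥ i, S k := fun i j hij =>
    Set.biInter_subset_biInter_left fun k hk => le_trans hij hk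
  refine h1.trans ?_
  rw [hmono.measure_iUnion]
  exact iSup_le fun i => (measure_mono (Set.biInter_subset_of_mem (le_refl i))).trans (hS i)

lemma probAtLeast_of_measure_le {Ω : Type*} [MeasurableSpace Ω] {μ : Measure Ω}
    [IsProbabilityMeasure μ] {E G : Set Ω} {β : ℝ} (hβ : 0 ≤ β)
    (hE : μ E ≤ ENNReal.ofReal β) (h : ∀ᵐ ω ∂μ, ω ∉ G → ω ∈ E) : ProbAtLeast μ G (1 - β) := by
  refine ⟨(toMeasurable μ Gᶜ)ᶜ, (measurableSet_toMeasurable _ _).compl, ?_, ?_⟩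
  · rw [Set.compl_subset_comm]
    exact subset_toMeasurable _ _
  · rw [probReal_compl_eq_one_sub (measurableSet_toMeasurable _ _), measureReal_def,
      measure_toMeasurable]
    have : (μ Gᶜ).toReal ≤ β :=
      ENNReal.toReal_le_of_le_ofReal hβ ((measure_mono_ae h).trans hE)
    linarith

lemma binomTail_le_of_sampleSize_le {n N : ℕ} {ε β : ℝ} (h0 : 0 ≤ ε) (h1 : ε ≤ 1)
    (h : sampleSize n ε β ≤ N) : binomTail n N ε ≤ β := by
  by_contra! hlt
  have : ((N + 1 : ℕ) : ℕ∞) ≤ sampleSize n ε β := by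
    refine le_iInf₂ fun m hm => ?_
    have hm' : binomTail n m ε ≤ β := hm
    rw [Nat.cast_le]
    by_contra! hmN
    exact absurd ((binomTail_antitone h0 h1 (Nat.lt_succ_iff.1 hmN)).trans hm') (not_le.2 hlt)
  have := this.trans h
  rw [Nat.cast_le] at this
  omega

/-! ### The scenario bound by random perturbation -/

/-- The uniform distribution on the unit interval. -/
noncomputable def unif : Measure ℝ := volume.restrict (Set.Icc 0 1)

instance : IsProbabilityMeasure unif := ⟨by simp [unif]⟩

namespace Program

variable {X C B Y : Type*} [NormedAddCommGroup X] [NormedSpace ℝ X]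
  [AddCommGroup C] [Module ℝ C] [NormedAddCommGroup B] [NormedSpace ℝ B]
  [AddCommGroup Y] [Module ℝ Y] {n : ℕ} (L : Program X C B Y n)

lemma le_of_mem_dualCone {α : Fin n → ℝ} (hα : α ∈ L.feasible) {y : Y} (hy : y ∈ L.dualCone) :
    L.pB L.b y ≤ α ⬝ᵥ L.AnAdj y := by
  have : 0 ≤ L.pB (L.An α - L.b) y := hy hα.1
  rw [map_sub, LinearMap.sub_apply, pB_An] at this
  linarith

lemma mem_dualCone_of_mem_extremal {y : Y} (hy : y ∈ L.extremal) : y ∈ L.dualCone := hy.1.1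

variable [MeasurableSpace Y]

lemma measurable_AnAdj (hmeas : ∀ v : B, Measurable fun y : Y => L.pB v y) :
    Measurable L.AnAdj :=
  measurable_pi_lambda _ fun _ => hmeas _

/-- The scenario program with randomly relaxed constraints and a regularized objective. -/
noncomputable def perturbed (hmeas : ∀ v : B, Measurable fun y : Y => L.pB v y)
    {α₀ : Fin n → ℝ} (hα₀ : α₀ ∈ L.feasible) (t : ℝ) (ht : 0 < t) : SampledProgram (Y × ℝ) n where
  D := {α | L.R α ≤ L.θP}
  isCompact_D := L.isCompact_R_le _
  convex_D := L.convex_R_le _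
  α₀ := α₀
  α₀_mem := hα₀.2
  a z := L.AnAdj z.1
  measurable_a := (L.measurable_AnAdj hmeas).comp measurable_fst
  -- The slack of the relaxed constraint at `α₀`. It is nonnegative on the dual cone for nonnegative
  -- relaxations; the absolute value in `f` keeps `α₀` feasible for all other `z` too.
  s z := α₀ ⬝ᵥ L.AnAdj z.1 - L.pB L.b z.1 + t * z.2
  measurable_s := by
    have h1 : Measurable fun z : Y × ℝ => L.AnAdj z.1 :=
      (L.measurable_AnAdj hmeas).comp measurable_fst
    have h2 : Measurable fun z : Y × ℝ => L.pB L.b z.1 := (hmeas L.b).comp measurable_fst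
    simp only [dotProduct]
    fun_prop
  c := L.cvec
  t := t
  t_pos := ht

variable {L} {hmeas : ∀ v : B, Measurable fun y : Y => L.pB v y} {α₀ : Fin n → ℝ}
  {hα₀ : α₀ ∈ L.feasible} {t : ℝ} {ht : 0 < t}

lemma perturbed_f {z : Y × ℝ} (hz : z.1 ∈ L.dualCone) (hz' : 0 ≤ z.2) (α : Fin n → ℝ) :
    (L.perturbed hmeas hα₀ t ht).f z α = L.pB L.b z.1 - α ⬝ᵥ L.AnAdj z.1 - t * z.2 := by
  have h1 := L.le_of_mem_dualCone hα₀ hz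
  have h2 : 0 ≤ t * z.2 := mul_nonneg ht.le hz'
  simp only [SampledProgram.f, perturbed]
  rw [abs_of_nonneg (by linarith), sub_dotProduct]
  ring

variable {P : Measure Y}

/-- For fixed y the constraint value is affine in the uniform variable with slope -t ≠ 0. -/
lemma perturbed_atomless (hP : ∀ᵐ y ∂P, y ∈ L.extremal) :
    (L.perturbed hmeas hα₀ t ht).Atomless (P.prod unif) := by
  intro α r
  have hT : MeasurableSet {z | (L.perturbed hmeas hα₀ t ht).f z α = r} :=
    measurableSet_eq_fun (SampledProgram.measurable_f_comp _ measurable_id measurable_const)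
      measurable_const
  rw [Measure.measure_prod_null hT]
  filter_upwards [hP] with y hy
  rw [unif, Measure.restrict_apply' measurableSet_Icc]
  refine Set.Subsingleton.measure_zero ?_ _
  rintro u ⟨hu, hu0⟩ v ⟨hv, hv0⟩
  have hu' : (L.perturbed hmeas hα₀ t ht).f (y, u) α = r := hu
  have hv' : (L.perturbed hmeas hα₀ t ht).f (y, v) α = r := hv
  rw [perturbed_f (L.mem_dualCone_of_mem_extremal hy) hu0.1] at hu'
  rw [perturbed_f (L.mem_dualCone_of_mem_extremal hy) hv0.1] at hv'
  exact mul_left_cancel₀ ht.ne' (by linarith)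

/-- The samples of the perturbed program that are almost surely drawn. -/
lemma ae_perturbed_sample (hP : ∀ᵐ y ∂P, y ∈ L.extremal) :
    ∀ᵐ z ∂(P.prod unif), z.1 ∈ L.dualCone ∧ z.2 ∈ Set.Icc (0 : ℝ) 1 := by
  have h1 : ∀ᵐ z ∂(P.prod unif), z.1 ∈ L.extremal :=
    Measure.quasiMeasurePreserving_fst.ae hP
  have h2 : ∀ᵐ z ∂(P.prod unif), z.2 ∈ Set.Icc (0 : ℝ) 1 :=
    Measure.quasiMeasurePreserving_snd.ae (ae_restrict_mem measurableSet_Icc)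
  filter_upwards [h1, h2] with z hz1 hz2
  exact ⟨L.mem_dualCone_of_mem_extremal hz1, hz2⟩

lemma ae_pi_of_ae {Z : Type*} [MeasurableSpace Z] {Q : Measure Z} [IsProbabilityMeasure Q]
    {p : Z → Prop} (h : ∀ᵐ z ∂Q, p z) (N : ℕ) :
    ∀ᵐ z ∂(Measure.pi fun _ : Fin N => Q), ∀ j, p (z j) :=
  ae_all_iff.2 fun j => (Measure.quasiMeasurePreserving_eval (fun _ : Fin N => Q) j).ae h

variable (L P)

/-- The probability that a new constraint is violated by `α`. -/
noncomputable def risk (α : Fin n → ℝ) : ℝ := P.real {y | 0 < L.pB (-L.An α + L.b) y}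

variable {L P} [IsProbabilityMeasure P]

/-- Along a sequence of vanishing perturbations, the optimizers of the perturbed programs
accumulate only at optimizers of the scenario program, and the risk is lower semicontinuous. -/
lemma eventually_lt_risk (hP : ∀ᵐ y ∂P, y ∈ L.extremal) {τ : ℕ → ℝ} (hτ : ∀ k, 0 < τ k)
    (hlim : Filter.Tendsto τ Filter.atTop (nhds 0)) {N : ℕ} {z : Fin N → Y × ℝ}
    (hz : ∀ j, (z j).1 ∈ L.dualCone ∧ (z j).2 ∈ Set.Icc (0 : ℝ) 1) {ε : ℝ} (h0 : 0 ≤ ε)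
    (hε : ∀ α, L.IsOptimizer (fun j => (z j).1) α → ε < L.risk P α) :
    ∀ᶠ k in Filter.atTop, ε < (P.prod unif).real {x | 0 < (L.perturbed hmeas hα₀ (τ k) (hτ k)).f x
      ((L.perturbed hmeas hα₀ (τ k) (hτ k)).opt (Set.range z))} := by
  by_contra hcon
  -- Otherwise the perturbed risk is at most ε along a subsequence; a limit `α` of its optimizers is
  -- shown to be a scenario optimizer of risk at most ε.
  obtain ⟨φ, hφ, hle⟩ := Filter.extraction_of_frequently_atTop (Filter.not_eventually.1 hcon)
  let M : ℕ → SampledProgram (Y × ℝ) n := fun k => L.perturbed hmeas hα₀ (τ k) (hτ k)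
  have hoptmem (k : ℕ) := (M k).opt_mem (Set.range z)
  obtain ⟨α, hα, ψ, hψ, hconv⟩ := (L.isCompact_R_le L.θP).tendsto_subseq
    (x := fun k => (M (φ k)).opt (Set.range z)) (fun k => (hoptmem (φ k)).1)
  let i : ℕ → ℕ := fun k => φ (ψ k)
  have hi : Filter.Tendsto i Filter.atTop Filter.atTop := hφ.tendsto_atTop.comp hψ.tendsto_atTop
  have hτi : Filter.Tendsto (fun k => τ (i k)) Filter.atTop (nhds 0) := hlim.comp hi
  have hαi : Filter.Tendsto (fun k => (M (i k)).opt (Set.range z)) Filter.atTop (nhds α) := hconv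
  have hdot (v : Fin n → ℝ) : Filter.Tendsto (fun k => (M (i k)).opt (Set.range z) ⬝ᵥ v)
      Filter.atTop (nhds (α ⬝ᵥ v)) :=
    ((by fun_prop : Continuous fun β : Fin n → ℝ => β ⬝ᵥ v).tendsto α).comp hαi
  have hf {x : Y × ℝ} (hx : x.1 ∈ L.dualCone) (hx' : 0 ≤ x.2) : Filter.Tendsto
      (fun k => (M (i k)).f x ((M (i k)).opt (Set.range z))) Filter.atTop
      (nhds (L.pB L.b x.1 - α ⬝ᵥ L.AnAdj x.1)) := by
    simp only [M, perturbed_f hx hx']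
    have := ((hdot (L.AnAdj x.1)).const_sub (L.pB L.b x.1)).sub (hτi.mul_const x.2)
    simpa using this
  have hoptimal : L.IsOptimizer (fun j => (z j).1) α := by
    refine ⟨⟨fun j => ?_, hα⟩, fun β hβ => ?_⟩
    · have := le_of_tendsto (hf (hz j).1 (hz j).2.1)
        (.of_forall fun k => (hoptmem (i k)).2 (z j) ⟨j, rfl⟩)
      linarith
    · have hβfeas (k : ℕ) : β ∈ (M k).feas (Set.range z) := by
        refine ⟨hβ.2, ?_⟩
        rintro _ ⟨j, rfl⟩
        simp only [M]
        rw [perturbed_f (hz j).1 (hz j).2.1]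
        have h1 := hβ.1 j
        have h2 := mul_nonneg (hτ k).le (hz j).2.1
        linarith
      have hobj (k : ℕ) := (M (i k)).obj_opt_le (hβfeas (i k))
      have hsq : Filter.Tendsto (fun k => (M (i k)).opt (Set.range z) ⬝ᵥ
          (M (i k)).opt (Set.range z)) Filter.atTop (nhds (α ⬝ᵥ α)) :=
        ((by fun_prop : Continuous fun β : Fin n → ℝ => β ⬝ᵥ β).tendsto α).comp hαi
      have hl := (hdot L.cvec).add (hτi.mul hsq)
      have hr := (hτi.mul_const (β ⬝ᵥ β)).const_add (β ⬝ᵥ L.cvec)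
      have := le_of_tendsto_of_tendsto' hl hr hobj
      simpa using this
  have hrisk := hε α hoptimal
  refine absurd hrisk (not_lt.2 ?_)
  have hprod : (P.prod unif) {x | 0 < L.pB (-L.An α + L.b) x.1} =
      P {y | 0 < L.pB (-L.An α + L.b) y} := by
    have : {x : Y × ℝ | 0 < L.pB (-L.An α + L.b) x.1} =
        {y | 0 < L.pB (-L.An α + L.b) y} ×ˢ Set.univ := by ext; simp
    rw [this, Measure.prod_prod, measure_univ, mul_one]
  rw [risk, measureReal_def, ← hprod]
  -- A constraint strictly violated at the limit is eventually violated along the subsequence.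
  refine ENNReal.toReal_le_of_le_ofReal h0 (measure_le_of_eventually_mem
    (S := fun k => {x | 0 < (M (i k)).f x ((M (i k)).opt (Set.range z))}) ?_ fun k => ?_)
  · filter_upwards [ae_perturbed_sample hP] with x hx hpos
    have hpos : 0 < L.pB (-L.An α + L.b) x.1 := hpos
    rw [pB_residual] at hpos
    exact (hf hx.1 hx.2.1).eventually_const_lt hpos
  · rw [← ofReal_measureReal]
    exact ENNReal.ofReal_le_ofReal (not_lt.1 (hle (ψ k)))

/-- The scenario bound: the optimizers of the scenario program rarely have a risk above `ε`. -/
theorem measure_lt_risk_le (hmeas : ∀ v : B, Measurable fun y : Y => L.pB v y)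
    (hne : L.feasible.Nonempty) (hn : 0 < n)
    (hP : ∀ᵐ y ∂P, y ∈ L.extremal) (N : ℕ) {ε : ℝ} (h0 : 0 ≤ ε) (h1 : ε ≤ 1) :
    (Measure.pi fun _ : Fin N => P) {ω | ∀ α, L.IsOptimizer ω α → ε < L.risk P α} ≤
      ENNReal.ofReal (binomTail n N ε) := by
  obtain ⟨α₀, hα₀⟩ := hne
  set E := {ω : Fin N → Y | ∀ α, L.IsOptimizer ω α → ε < L.risk P α}
  let τ : ℕ → ℝ := fun k => 1 / ((k : ℝ) + 1)
  have hτ (k : ℕ) : 0 < τ k := by positivity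
  have hlim : Filter.Tendsto τ Filter.atTop (nhds 0) := tendsto_one_div_add_atTop_nhds_zero_nat
  have hE : (Measure.pi fun _ : Fin N => P) E =
      (Measure.pi fun _ : Fin N => P.prod unif) {z | (fun j => (z j).1) ∈ E} := by
    have hmp := measurePreserving_arrowProdEquivProdArrow Y ℝ (Fin N) (fun _ => P) (fun _ => unif)
    have h2 := hmp.measure_preimage_equiv (E ×ˢ Set.univ)
    rw [Measure.prod_prod, measure_univ, mul_one] at h2
    rw [← h2]
    congr 1
    ext z
    simp [MeasurableEquiv.arrowProdEquivProdArrow, Equiv.arrowProdEquivProdArrow]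
  rw [hE]
  refine measure_le_of_eventually_mem
    (S := fun k => {z | ε < (P.prod unif).real {x | 0 < (L.perturbed hmeas hα₀ (τ k) (hτ k)).f x
      ((L.perturbed hmeas hα₀ (τ k) (hτ k)).opt (Set.range z))}}) ?_ fun k => ?_
  · filter_upwards [ae_pi_of_ae (ae_perturbed_sample hP) N] with z hz hzE
    exact eventually_lt_risk hP hτ hlim hz h0 hzE
  · rw [← ofReal_measureReal]
    exact ENNReal.ofReal_le_ofReal ((perturbed_atomless hP).risk_tail_le hn N h0 h1)

/-- The non-strict form needed for (b), where `g` bounds the risk only weakly; it follows by letting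
the level increase to ε. -/
theorem measure_le_risk_le (hmeas : ∀ v : B, Measurable fun y : Y => L.pB v y)
    (hne : L.feasible.Nonempty) (hn : 0 < n)
    (hP : ∀ᵐ y ∂P, y ∈ L.extremal) (N : ℕ) {ε : ℝ} (h0 : 0 ≤ ε) (h1 : ε ≤ 1) :
    (Measure.pi fun _ : Fin N => P) {ω | ∀ α, L.IsOptimizer ω α → ε ≤ L.risk P α} ≤
      ENNReal.ofReal (binomTail n N ε) := by
  rcases h0.eq_or_lt with rfl | hpos
  · obtain ⟨k, rfl⟩ : ∃ k, n = k + 1 := ⟨n - 1, by omega⟩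
    rw [binomTail_zero_right, ENNReal.ofReal_one]
    exact prob_le_one
  have hcont : Filter.Tendsto (fun e => ENNReal.ofReal (binomTail n N e))
      (nhdsWithin ε (Set.Iio ε)) (nhds (ENNReal.ofReal (binomTail n N ε))) :=
    ((ENNReal.continuous_ofReal.comp (continuous_binomTail n N)).tendsto ε).mono_left
      nhdsWithin_le_nhds
  refine ge_of_tendsto hcont ?_
  have hev : ∀ᶠ e in nhdsWithin ε (Set.Iio ε), 0 < e :=
    mem_nhdsWithin_of_mem_nhds (Ioi_mem_nhds hpos)
  filter_upwards [hev, self_mem_nhdsWithin] with e he hlt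
  have hlt : e < ε := hlt
  refine (measure_mono fun ω hω α hα => ?_).trans
    (measure_lt_risk_le hmeas hne hn hP N he.le (hlt.le.trans h1))
  exact hlt.trans_le (hω α hα)

end Program

namespace Program

variable {X C B Y : Type*} [NormedAddCommGroup X] [NormedSpace ℝ X]
  [AddCommGroup C] [Module ℝ C] [NormedAddCommGroup B] [NormedSpace ℝ B]
  [AddCommGroup Y] [Module ℝ Y] {n : ℕ} (L : Program X C B Y n)

/-! ### Optimality gaps -/

/-- For n = 0 the dual norm on ℝⁿ vanishes, against the inf-sup condition at a `y` of norm one. -/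
lemma pos_of_mem_extremal {γ : ℝ} (h : L.Regular γ) {y : Y} (hy : y ∈ L.extremal) : 0 < n := by
  rcases Nat.eq_zero_or_pos n with rfl | hn
  · exfalso
    have h1 := h.inf_sup y hy.1.1
    have h2 : L.normY y = 1 := hy.1.2
    have h3 := L.mul_RDual_le (v := L.AnAdj y) (m := 0) one_pos fun α _ => by simp [dotProduct]
    have := h.γ_pos
    rw [h2] at h1
    linarith
  · exact hn

lemma JnN_le_Jn (hne : L.feasible.Nonempty) {N : ℕ} {ω : Fin N → Y}
    (hω : ∀ j, ω j ∈ L.dualCone) : L.JnN ω ≤ L.Jn :=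
  csInf_le_csInf (L.bddBelow_cost fun _ h => h.2) (hne.image _)
    (Set.image_mono fun _ hα => ⟨fun j => L.le_of_mem_dualCone hα (hω j), hα.2⟩)

lemma rho_nonneg : 0 ≤ L.rho :=
  Real.sSup_nonneg (by rintro _ ⟨α, _, rfl⟩; exact Finset.sum_nonneg fun i _ => abs_nonneg _)

lemma normBound_nonneg (h : 0 ≤ L.θP) : 0 ≤ L.θP * L.rho * opNorm L.A + ‖L.b‖ := by
  have h1 : 0 ≤ opNorm L.A := Real.sSup_nonneg (by rintro _ ⟨x, _, rfl⟩; exact norm_nonneg _)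
  have := mul_nonneg (mul_nonneg h L.rho_nonneg) h1
  have := norm_nonneg L.b
  linarith

lemma norm_residual_le (hA : BddAbove {r : ℝ | ∃ x : X, ‖x‖ ≤ 1 ∧ r = ‖L.A x‖}) (hθ : 0 < L.θP)
    {α : Fin n → ℝ} (hα : L.R α ≤ L.θP) :
    ‖-L.An α + L.b‖ ≤ L.θP * L.rho * opNorm L.A + ‖L.b‖ := by
  have hAx (i : Fin n) : ‖L.A (L.x i)‖ ≤ opNorm L.A := le_csSup hA ⟨L.x i, (L.x_norm i).le, rfl⟩
  have h1 : 0 ≤ opNorm L.A := Real.sSup_nonneg (by rintro _ ⟨x, _, rfl⟩; exact norm_nonneg _)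
  have hl1 : ∑ i, |α i| ≤ L.θP * L.rho := by
    have : ∑ i, |(L.θP⁻¹ • α) i| ≤ L.rho := by
      refine le_csSup (L.bddAbove_of_continuous (g := fun α => ∑ i, |α i|) (by fun_prop))
        ⟨_, ?_, rfl⟩
      rw [map_smul_eq_mul, norm_inv, Real.norm_of_nonneg hθ.le, inv_mul_le_iff₀ hθ, mul_one]
      exact hα
    simp only [Pi.smul_apply, smul_eq_mul, abs_mul, ← Finset.mul_sum] at this
    rwa [abs_of_pos (inv_pos.2 hθ), inv_mul_le_iff₀ hθ] at this
  have hAn : ‖L.An α‖ ≤ (∑ i, |α i|) * opNorm L.A := by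
    rw [Finset.sum_mul]
    refine (norm_sum_le _ _).trans (Finset.sum_le_sum fun i _ => ?_)
    rw [norm_smul, Real.norm_eq_abs]
    exact mul_le_mul_of_nonneg_left (hAx i) (abs_nonneg _)
  calc ‖-L.An α + L.b‖ ≤ ‖L.An α‖ + ‖L.b‖ := by simpa using norm_add_le (-L.An α) L.b
    _ ≤ _ := by
      have := mul_le_mul_of_nonneg_right hl1 h1
      linarith

variable {L}

lemma IsOptimizer.JnN_eq {N : ℕ} {ω : Fin N → Y} {α : Fin n → ℝ} (h : L.IsOptimizer ω α) :
    L.JnN ω = α ⬝ᵥ L.cvec :=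
  IsLeast.csInf_eq ⟨⟨α, h.1, rfl⟩, by rintro _ ⟨β, hβ, rfl⟩; exact h.2 β hβ⟩

lemma le_support (δ : B) {y : Y} (hy : y ∈ L.extremal) : L.pB δ y ≤ L.support δ := by
  refine le_csSup ⟨‖δ‖, ?_⟩ ⟨y, hy, rfl⟩
  rintro _ ⟨x, hx, rfl⟩
  have h1 := L.isDualPair_B.apply_le δ x
  have h2 : dualNorm L.pB x = 1 := hx.1.2
  rwa [h2, mul_one] at h1

variable [MeasurableSpace Y] {P : Measure Y}

lemma Regular.gap_le_of_risk_le {γ : ℝ} (hreg : L.Regular γ)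
    (hcompact : IsWeaklyCompact L.pB.flip {y : Y | y ∈ L.dualCone ∧ L.normY y ≤ 1})
    {JLB : ℝ} (hJ : JLB ≤ L.Jn) {h : (Fin n → ℝ) → ℝ → ℝ} (hh : L.IsTailBound P h) {ε : ℝ}
    (hε0 : 0 ≤ ε) (hε1 : ε < 1) {α : Fin n → ℝ} (hα : L.R α ≤ L.θP) (hrisk : L.risk P α ≤ ε) :
    L.Jn - α ⬝ᵥ L.cvec ≤ L.thetaD γ JLB * h α ε := by
  have hle : L.support (-L.An α + L.b) ≤ h α ε := by
    rcases le_or_gt (L.support (-L.An α + L.b)) 0 with h0 | h0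
    · exact h0.trans (hh α ε hε0 hε1).1
    -- At ζ equal to the support value, the tail event is exactly the violation event, so `tailProb`
    -- is the risk.
    · refine (hh α ε hε0 hε1).2 _ h0.le ?_
      refine le_trans (le_of_eq ?_) hrisk
      simp only [tailProb, risk, lt_add_iff_pos_left]
  refine hreg.Jn_sub_le hJ hα (hh α ε hε0 hε1).1 fun y hy => ?_
  exact le_mul_normY_of_le_extremal hcompact (hh α ε hε0 hε1).1
    (fun x hx => (le_support _ hx).trans hle) hy

lemma Regular.ballBound_le_risk [IsProbabilityMeasure P] {γ : ℝ} (hreg : L.Regular γ)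
    (hcompact : IsWeaklyCompact L.pB.flip {y : Y | y ∈ L.dualCone ∧ L.normY y ≤ 1})
    {JLB : ℝ} (hJ : JLB ≤ L.Jn) (hA : BddAbove {r : ℝ | ∃ x : X, ‖x‖ ≤ 1 ∧ r = ‖L.A x‖})
    {g : ℝ → ℝ} (hg : L.IsBallBound P g) {ε : ℝ} (hε : 0 < ε) {κ₀ : Y} (hκ₀ : κ₀ ∈ L.extremal)
    {α : Fin n → ℝ} (hα : L.R α ≤ L.θP) (hgap : ε < L.Jn - α ⬝ᵥ L.cvec) :
    g ((L.thetaD γ JLB * (L.θP * L.rho * opNorm L.A + ‖L.b‖))⁻¹ * ε) ≤ L.risk P α := by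
  have hθD := hreg.thetaD_nonneg hJ
  have hM := L.normBound_nonneg hreg.θP_pos.le
  set m := L.θP * L.rho * opNorm L.A + ‖L.b‖ with hm
  -- If the product is zero, its inverse is zero by convention; the ball of radius 0 is empty, so `g
  -- 0` is at most 0.
  rcases (mul_nonneg hθD hM).eq_or_lt with h0 | hpos
  · rw [← h0, inv_zero, zero_mul]
    refine (hg.le_ball κ₀ hκ₀ 0 le_rfl).trans ?_
    have : {y | L.normY (y - κ₀) < 0} = ∅ := by
      ext y
      exact iff_of_false (not_lt.2 (L.isDualPair_B.dualNorm_nonneg (y - κ₀))) id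
    rw [this, measureReal_empty]
    exact measureReal_nonneg
  have hθpos : 0 < L.thetaD γ JLB := pos_of_mul_pos_left hpos hM
  have hmpos : 0 < m := pos_of_mul_pos_right hpos hθD
  obtain ⟨κ, hκ, hκε⟩ : ∃ κ ∈ L.extremal, ε / L.thetaD γ JLB < L.pB (-L.An α + L.b) κ := by
    by_contra! hcon
    have h1 := hreg.Jn_sub_le hJ hα (div_pos hε hθpos).le fun y hy =>
      le_mul_normY_of_le_extremal hcompact (div_pos hε hθpos).le hcon hy
    rw [mul_div_cancel₀ _ hθpos.ne'] at h1
    linarith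
  refine (hg.le_ball κ hκ _ (mul_nonneg (inv_nonneg.2 hpos.le) hε.le)).trans
    (measureReal_mono fun y hy => ?_)
  have hy : L.normY (y - κ) < (L.thetaD γ JLB * m)⁻¹ * ε := hy
  -- The violation is Lipschitz in `y` with constant at most `m`, so within the radius it drops by
  -- less than ε/θ_D and remains positive.
  have h1 := L.isDualPair_B.apply_le (-(-L.An α + L.b)) (y - κ)
  change _ ≤ _ * L.normY (y - κ) at h1
  rw [norm_neg, map_neg, LinearMap.neg_apply, map_sub] at h1
  have h2 := mul_le_mul (L.norm_residual_le hA hreg.θP_pos hα) hy.le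
    (L.isDualPair_B.dualNorm_nonneg _) hM
  have h3 : m * ((L.thetaD γ JLB * m)⁻¹ * ε) = ε / L.thetaD γ JLB := by
    field_simp
  rw [← hm, h3] at h2
  change 0 < L.pB (-L.An α + L.b) y
  linarith

end Program

end ScenarioLP

theorem mainTheorem3 {X C B Y : Type*} [NormedAddCommGroup X] [NormedSpace ℝ X]
    [AddCommGroup C] [Module ℝ C] [NormedAddCommGroup B] [NormedSpace ℝ B]
    [AddCommGroup Y] [Module ℝ Y] {n : ℕ} (L : ScenarioLP.Program X C B Y n)
    -- the part of the dual unit ball in the dual cone is weakly compact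
    (hcompact : ScenarioLP.IsWeaklyCompact L.pB.flip {y : Y | y ∈ L.dualCone ∧ L.normY y ≤ 1})
    -- the regularity assumption and a lower bound of the optimal value
    (γ : ℝ) (hreg : L.Regular γ) (JLB : ℝ) (hJLB : JLB ≤ L.Jn)
    -- the sampling measure, on a σ-algebra for which the functionals `⟨v, ·⟩` are measurable
    [MeasurableSpace Y] (hmeas : ∀ v : B, Measurable (fun y : Y => L.pB v y))
    (P : MeasureTheory.Measure Y) [MeasureTheory.IsProbabilityMeasure P]
    (hP : ∀ᵐ y ∂P, y ∈ L.extremal) :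
    -- the a posteriori bound
    (∀ (h : (Fin n → ℝ) → ℝ → ℝ), L.IsTailBound P h →
      ∀ ε β : ℝ, 0 < ε → ε < 1 → 0 < β →
      ∀ N : ℕ, ScenarioLP.sampleSize n ε β ≤ N →
      ∀ αstar : (Fin N → Y) → (Fin n → ℝ),
        (∀ᵐ ω ∂(MeasureTheory.Measure.pi fun _ : Fin N => P), L.IsUniqueOptimizer ω (αstar ω)) →
        ScenarioLP.ProbAtLeast (MeasureTheory.Measure.pi fun _ : Fin N => P)
          {ω | 0 ≤ L.Jn - L.JnN ω ∧ L.Jn - L.JnN ω ≤ L.thetaD γ JLB * h (αstar ω) ε} (1 - β)) ∧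
    -- the a priori bound
    (BddAbove {r : ℝ | ∃ x : X, ‖x‖ ≤ 1 ∧ r = ‖L.A x‖} →
      ∀ g : ℝ → ℝ, L.IsBallBound P g →
      ∀ ε β : ℝ, 0 < ε → 0 < β →
      ∀ N : ℕ, ScenarioLP.sampleSize n
          (g ((L.thetaD γ JLB * (L.θP * L.rho * ScenarioLP.opNorm L.A + ‖L.b‖))⁻¹ * ε)) β ≤ N →
        ScenarioLP.ProbAtLeast (MeasureTheory.Measure.pi fun _ : Fin N => P)
          {ω | 0 ≤ L.Jn - L.JnN ω ∧ L.Jn - L.JnN ω ≤ ε} (1 - β)) := by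
  have hθP := hreg.θP_pos
  have hθD := hreg.thetaD_nonneg hJLB
  obtain ⟨κ₀, hκ₀⟩ := hP.exists
  have hn : 0 < n := L.pos_of_mem_extremal hreg hκ₀
  have hlower (N : ℕ) : ∀ᵐ ω ∂(MeasureTheory.Measure.pi fun _ : Fin N => P),
      0 ≤ L.Jn - L.JnN ω := by
    filter_upwards [ScenarioLP.Program.ae_pi_of_ae hP N] with ω hω
    exact sub_nonneg.2 (L.JnN_le_Jn hreg.feasible_nonempty fun j =>
      L.mem_dualCone_of_mem_extremal (hω j))
  refine ⟨fun h hh ε β hε0 hε1 hβ N hN αstar hα => ?_, fun hA g hg ε β hε hβ N hN => ?_⟩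
  · refine ScenarioLP.probAtLeast_of_measure_le hβ.le
      ((L.measure_lt_risk_le hmeas hreg.feasible_nonempty hn hP N hε0.le hε1.le).trans
        (ENNReal.ofReal_le_ofReal
          (ScenarioLP.binomTail_le_of_sampleSize_le hε0.le hε1.le hN))) ?_
    filter_upwards [hα, hlower N] with ω hω h0 hbad α hopt
    -- The risk bound is about events on which every optimizer is risky; uniqueness turns this into
    -- a statement about `αstar`.
    obtain rfl := hω.2 α hopt
    by_contra! hrisk
    refine hbad ⟨h0, ?_⟩
    rw [hopt.JnN_eq]
    exact hreg.gap_le_of_risk_le hcompact hJLB hh hε0.le hε1 hopt.1.2 hrisk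
  · set z := (L.thetaD γ JLB * (L.θP * L.rho * ScenarioLP.opNorm L.A + ‖L.b‖))⁻¹ with hz
    have hz0 : 0 ≤ z := inv_nonneg.2 (mul_nonneg hθD (L.normBound_nonneg hθP.le))
    have hg01 := hg.mem_unit (z * ε) (mul_nonneg hz0 hε.le)
    refine ScenarioLP.probAtLeast_of_measure_le hβ.le
      ((L.measure_le_risk_le hmeas hreg.feasible_nonempty hn hP N hg01.1 hg01.2).trans
        (ENNReal.ofReal_le_ofReal
          (ScenarioLP.binomTail_le_of_sampleSize_le hg01.1 hg01.2 hN))) ?_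
    filter_upwards [hlower N] with ω h0 hbad α hopt
    refine hreg.ballBound_le_risk hcompact hJLB hA hg hε hκ₀ hopt.1.2 ?_
    rw [← hopt.JnN_eq]
    by_contra! hle
    exact hbad ⟨h0, hle⟩
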